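/- Let $t\subset\mathbb R^2$ be a tile, i.e. a nonempty compact set that is the closure of its interior and is invariant under rotation by $2\pi/6$ about the origin, its center (for instance the zipper tile: a regular hexagon of area $1$ whose sides are modified by fringes and whose corners are modified by hooks and inlets). Copies of $t$ are obtained by translations and rotations, and the position of a copy is its center together with its direction modulo $2\pi/6$. A packing is a collection of copies of $t$ with pairwise disjoint interiors. Let $X$ be the space of all packings of the plane by $t$, with the topology of Hausdorff convergence, on compact sets, of the collection of positions of the tiles (the Fell topology), and its Borel $\sigma$-algebra. For integers $n,m$ let $T_n$ be the unit tangent bundle of the torus $\mathbb R^2/(n\mathbb Z)^2$ modulo rotation by $2\pi/6$, with its flat metric, and let $X_{n,m}\subset T_n^m/\mathrm{Sym}(m)$ be the set of packings of the torus by exactly $m$ tiles (those whose lift to the plane is a packing). Two non-overlapping copies of $t$ are linked if, when one is held fixed, the other can be moved continuously, without overlapping the first, only by a bounded amount; the link is tight if no movement at all is possible, and loose otherwise. Let the top dimension of $X_{n,m}$ be the maximum over $k$ of the Hausdorff dimension of the set of packings in $X_{n,m}$ with exactly $k$ tight links, and let $\mu_{n,m}$ be the normalized Hausdorff measure on $X_{n,m}$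 in the top dimension, for the quotient metric, whenever it can be normalized; view $\mu_{n,m}$ as a probability measure on $n\mathbb Z\times n\mathbb Z$-periodic packings in $X$. A limiting measure $\mu_d$ of density $d$ is any probability measure on $X$ that is the weak* limit of measures $\mu_{n_j,m_j}$ with $n_j\to\infty$ and $m_j/n_j^2\to d$. The linked (loose-linked) component of a tile of a packing is the set of tiles of the packing that are joined to it by a finite chain of tiles of the packing in which consecutive tiles are linked (loose linked). Then there is $d_2>0$, depending only on $t$, such that for every $d<d_2$ and every limiting measure $\mu_d$ of density $d$, the $\mu_d$-probability that the origin lies in a tile belonging to an infinite linked component is zero, and likewise the $\mu_d$-probability that the origin lies in a tile belonging to an infinite loose-linked component is zero. -/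

import Mathlib

open MeasureTheory Set Filter Topology
open scoped ENNReal

noncomputable section

namespace Packings

/-- A tile shape in the plane `ℂ`, with its center at the origin: a nonempty compact set that is the
closure of its interior and is mapped to itself by the rotation by `2π/6` about its center. -/
structure IsTile (t : Set ℂ) : Prop where
  nonempty : t.Nonempty
  isCompact : IsCompact t
  closure_interior : closure (interior t) = t
  rotation : ∀ w ∈ t, Complex.exp ((Real.pi / 3 : ℝ) * Complex.I) * w ∈ t

/-- The closure of any nonempty bounded open set with six-fold symmetry is a tile; so are, for
instance, a regular hexagon and every fringed modification of it that keeps its rotations. -/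
theorem isTile_closure {U : Set ℂ} (hU : IsOpen U) (hne : U.Nonempty)
    (hb : Bornology.IsBounded U)
    (hrot : ∀ w ∈ U, Complex.exp ((Real.pi / 3 : ℝ) * Complex.I) * w ∈ U) :
    IsTile (closure U) where
  nonempty := hne.closure
  isCompact := hb.isCompact_closure
  closure_interior := by
    refine subset_antisymm (closure_minimal interior_subset isClosed_closure) ?_
    exact closure_mono (interior_maximal subset_closure hU)
  rotation := fun w hw => map_mem_closure (continuous_const_mul _) hw hrot

/-- Directions modulo rotation by `2π/6`: the circle of length `2π/6`. -/
abbrev Direction : Type := AddCircle (Real.pi / 3)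

/-- The position of a tile in the plane: its center, and its direction modulo `2π/6`. -/
abbrev Placement : Type := ℂ × Direction

/-- The copy of the tile `t` that has center `p.1` and direction `p.2`.
(All real representatives `θ` of `p.2` give the same set, by the six-fold symmetry of `t`.) -/
def copy (t : Set ℂ) (p : Placement) : Set ℂ :=
  {x | ∃ θ : ℝ, (θ : Direction) = p.2 ∧ ∃ w ∈ t, x = p.1 + Complex.exp (θ * Complex.I) * w}

/-- The copies of `t` at `p` and at `q` have disjoint interiors. -/
def NonOverlapping (t : Set ℂ) (p q : Placement) : Prop :=
  Disjoint (interior (copy t p)) (interior (copy t q))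

/-! ### The space of packings of the plane -/

/-- The space of all packings of the plane by `t`; a packing is given by the set of the positions of
its tiles. -/
def Packing (t : Set ℂ) : Type :=
  {P : Set Placement // P.Pairwise (NonOverlapping t)}

/-- The set of (the positions of) the tiles of a packing. -/
def Packing.tiles {t : Set ℂ} (P : Packing t) : Set Placement := P.1

/-- The topology of Hausdorff convergence on compact subsets, which for locally finite collections of
tiles is the Fell topology: it is generated by the events that some tile of the packing has its
position in a given open set, and that no tile has its position in a given compact set. -/
instance (t : Set ℂ) : TopologicalSpace (Packing t) :=
  TopologicalSpace.generateFrom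
    ({A | ∃ U : Set Placement, IsOpen U ∧ A = {P : Packing t | (P.tiles ∩ U).Nonempty}} ∪
      {A | ∃ K : Set Placement, IsCompact K ∧ A = {P : Packing t | P.tiles ∩ K = ∅}})

instance (t : Set ℂ) : MeasurableSpace (Packing t) := borel (Packing t)

instance (t : Set ℂ) : BorelSpace (Packing t) := ⟨rfl⟩

/-! ### Links and linked components -/

/-- The positions to which the copy of `t` at `q` can be moved continuously, while the copy at `p` is
held fixed, without overlapping that copy. -/
def reachable (t : Set ℂ) (p q : Placement) : Set Placement :=
  {q' | JoinedIn {x | NonOverlapping t p x} q q'}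

/-- Two (non-overlapping) copies of the tile are linked if, when one is held fixed, the other can be
moved continuously only by a bounded amount without overlapping the first. -/
def Linked (t : Set ℂ) (p q : Placement) : Prop :=
  NonOverlapping t p q ∧ Bornology.IsBounded (reachable t p q)

/-- A tight link permits no movement of one tile while the other is held fixed. -/
def TightLinked (t : Set ℂ) (p q : Placement) : Prop :=
  Linked t p q ∧ reachable t p q = {q}

/-- A link that is not tight is loose. -/
def LooseLinked (t : Set ℂ) (p q : Placement) : Prop :=
  Linked t p q ∧ ¬ TightLinked t p q

/-- The component of the tile `p` in the packing `P` for a relation `L` between tiles: all the tiles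
that are joined to `p` by a finite chain of tiles of `P`, consecutive ones being in relation `L`. -/
def component {t : Set ℂ} (L : Placement → Placement → Prop) (P : Packing t) (p : Placement) :
    Set Placement :=
  {q | Relation.ReflTransGen (fun a b => a ∈ P.tiles ∧ b ∈ P.tiles ∧ L a b) p q}

/-- The event that the origin is inside (a tile of) an infinite component of the packing. -/
def originInInfinite {t : Set ℂ} (L : Placement → Placement → Prop) : Set (Packing t) :=
  {P | ∃ p ∈ P.tiles, (0 : ℂ) ∈ copy t p ∧ (component L P p).Infinite}

/-! ### Unordered tuples: the metric space `Z ^ m / Sym(m)` -/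

/-- Two `m`-tuples are equivalent if they differ by a permutation of the factors. -/
def permSetoid (Z : Type*) (m : ℕ) : Setoid (PiLp 2 (fun _ : Fin m => Z)) where
  r x y := ∃ σ : Equiv.Perm (Fin m), ∀ i, y i = x (σ i)
  iseqv :=
    { refl := fun _ => ⟨1, fun _ => rfl⟩
      symm := fun {x y} ⟨σ, h⟩ => ⟨σ⁻¹, fun i => by rw [h]; simp⟩
      trans := fun {x y z} ⟨σ, h⟩ ⟨τ, k⟩ => ⟨σ * τ, fun i => by rw [k, h]; rfl⟩ }

/-- The quotient `Z ^ m / Sym(m)`. -/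
def UnorderedTuple (Z : Type*) (m : ℕ) : Type _ := Quotient (permSetoid Z m)

namespace UnorderedTuple

variable {Z : Type*} {m : ℕ}

/-- Forget the order of a tuple. -/
def mk (x : PiLp 2 (fun _ : Fin m => Z)) : UnorderedTuple Z m := Quotient.mk (permSetoid Z m) x

/-- The set of the entries of an unordered tuple. -/
def entries (c : UnorderedTuple Z m) : Set Z := {a | ∃ x, mk x = c ∧ ∃ i, x i = a}

/-- The entries of the tuple are pairwise distinct. -/
def Distinct (c : UnorderedTuple Z m) : Prop := ∀ x, mk x = c → Function.Injective fun i => x i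

theorem mk_eq_iff {x y : PiLp 2 (fun _ : Fin m => Z)} :
    mk x = mk y ↔ ∃ σ : Equiv.Perm (Fin m), ∀ i, y i = x (σ i) :=
  Quotient.eq (r := permSetoid Z m)

/-- Permute the factors. -/
def perm (σ : Equiv.Perm (Fin m)) (x : PiLp 2 (fun _ : Fin m => Z)) : PiLp 2 (fun _ : Fin m => Z) :=
  WithLp.toLp 2 fun i => x (σ i)

theorem mk_perm (σ : Equiv.Perm (Fin m)) (x : PiLp 2 (fun _ : Fin m => Z)) : mk (perm σ x) = mk x :=
  (mk_eq_iff.2 ⟨σ, fun _ => rfl⟩).symm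

theorem eq_perm_of_mk_eq {x y : PiLp 2 (fun _ : Fin m => Z)} (h : mk x = mk y) :
    ∃ σ : Equiv.Perm (Fin m), y = perm σ x := by
  obtain ⟨σ, hσ⟩ := mk_eq_iff.1 h
  exact ⟨σ, PiLp.ext hσ⟩

theorem edist_perm [EMetricSpace Z] (σ : Equiv.Perm (Fin m)) (x y : PiLp 2 (fun _ : Fin m => Z)) :
    edist (perm σ x) (perm σ y) = edist x y := by
  rw [PiLp.edist_eq_sum (by norm_num), PiLp.edist_eq_sum (by norm_num)]
  congr 1
  exact Equiv.sum_comp σ fun i => edist (x i) (y i) ^ (2 : ℝ≥0∞).toReal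

/-- The quotient distance: the least Euclidean distance between orderings of the two tuples. -/
instance [EMetricSpace Z] : EDist (UnorderedTuple Z m) :=
  ⟨fun c d => ⨅ (x) (y) (_ : mk x = c) (_ : mk y = d), edist x y⟩

theorem edist_def [EMetricSpace Z] (c d : UnorderedTuple Z m) :
    edist c d = ⨅ (x) (y) (_ : mk x = c) (_ : mk y = d), edist x y := rfl

theorem edist_mk [EMetricSpace Z] (x y : PiLp 2 (fun _ : Fin m => Z)) :
    edist (mk x) (mk y) = ⨅ σ : Equiv.Perm (Fin m), edist x (perm σ y) := by
  rw [edist_def]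
  apply le_antisymm
  · exact le_iInf fun σ => iInf₂_le_of_le x (perm σ y) (iInf₂_le_of_le rfl (mk_perm σ y) le_rfl)
  · refine le_iInf fun x' => le_iInf fun y' => le_iInf fun hx => le_iInf fun hy => ?_
    obtain ⟨σ, rfl⟩ := eq_perm_of_mk_eq hx.symm
    obtain ⟨τ, rfl⟩ := eq_perm_of_mk_eq hy.symm
    refine iInf_le_of_le (τ * σ⁻¹) (le_of_eq ?_)
    rw [← edist_perm σ x]
    congr 1
    apply PiLp.ext
    intro i
    simp [perm]

instance [EMetricSpace Z] : EMetricSpace (UnorderedTuple Z m) where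
  edist_self c := by
    induction c using Quotient.inductionOn with
    | h x =>
      refine le_antisymm ?_ bot_le
      exact iInf₂_le_of_le x x (iInf₂_le_of_le rfl rfl (edist_self x).le)
  edist_comm c d := by
    rw [edist_def, edist_def, iInf_comm]
    refine iInf_congr fun y => iInf_congr fun x => ?_
    rw [iInf_comm]
    simp_rw [edist_comm]
  edist_triangle a b c := by
    induction a using Quotient.inductionOn with
    | h x =>
    induction b using Quotient.inductionOn with
    | h y =>
    induction c using Quotient.inductionOn with
    | h z =>
      change edist (mk x) (mk z) ≤ edist (mk x) (mk y) + edist (mk y) (mk z)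
      rw [edist_mk, edist_mk, edist_mk]
      refine ENNReal.le_iInf_add_iInf fun σ τ => iInf_le_of_le (τ * σ) ?_
      calc edist x (perm (τ * σ) z) ≤ edist x (perm σ y) + edist (perm σ y) (perm (τ * σ) z) :=
            edist_triangle _ _ _
        _ = edist x (perm σ y) + edist y (perm τ z) := by
            rw [← edist_perm σ y (perm τ z)]
            rfl
  eq_of_edist_eq_zero {a b} := by
    induction a using Quotient.inductionOn with
    | h x =>
    induction b using Quotient.inductionOn with
    | h y =>
      intro h
      change edist (mk x) (mk y) = 0 at h
      change mk x = mk y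
      rw [edist_mk] at h
      obtain ⟨σ, hσ⟩ := exists_eq_ciInf_of_finite (f := fun σ => edist x (perm σ y))
      have h0 := hσ.trans h
      rw [edist_eq_zero.1 h0, mk_perm]

instance [EMetricSpace Z] : MeasurableSpace (UnorderedTuple Z m) := borel _

instance [EMetricSpace Z] : BorelSpace (UnorderedTuple Z m) := ⟨rfl⟩

end UnorderedTuple

/-! ### Packings of the torus -/

/-- The unit tangent bundle, modulo rotation by `2π/6`, of the `n × n` torus `ℝ² / (nℤ)²`, with its
natural (flat) metric. -/
abbrev TorusPlacement (n : ℕ) : Type :=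
  WithLp 2 (WithLp 2 (AddCircle (n : ℝ) × AddCircle (n : ℝ)) × Direction)

/-- The position on the `n × n` torus of the image of a tile of the plane. -/
def toTorus (n : ℕ) (p : Placement) : TorusPlacement n :=
  WithLp.toLp 2 (WithLp.toLp 2 ((p.1.re : AddCircle (n : ℝ)), (p.1.im : AddCircle (n : ℝ))), p.2)

/-- The `n × n`-periodic collection of tiles of the plane whose image on the torus is `c`. -/
def periodicLift (n : ℕ) {m : ℕ} (c : UnorderedTuple (TorusPlacement n) m) : Set Placement :=
  {p | toTorus n p ∈ c.entries}

/-- The space of packings of the `n × n` torus by exactly `m` tiles, as a subset of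
`T_n ^ m / Sym(m)`. -/
def torusPackings (t : Set ℂ) (n m : ℕ) : Set (UnorderedTuple (TorusPlacement n) m) :=
  {c | c.Distinct ∧ (periodicLift n c).Pairwise (NonOverlapping t)}

/-- The tight links between tiles on the torus. -/
def torusTightLinks (t : Set ℂ) (n : ℕ) {m : ℕ} (c : UnorderedTuple (TorusPlacement n) m) :
    Set (Sym2 (TorusPlacement n)) :=
  {e | ∃ p ∈ periodicLift n c, ∃ q ∈ periodicLift n c,
    TightLinked t p q ∧ e = s(toTorus n p, toTorus n q)}

/-- The packings of the `n × n` torus by exactly `m` tiles that contain exactly `k` tight links. -/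
def torusPackingsWithLinks (t : Set ℂ) (n m k : ℕ) : Set (UnorderedTuple (TorusPlacement n) m) :=
  {c ∈ torusPackings t n m | (torusTightLinks t n c).ncard = k}

/-- The top dimension of the space of packings of the `n × n` torus by `m` tiles: the maximal
dimension of the subspaces of packings with a given number of tight links. -/
def topDim (t : Set ℂ) (n m : ℕ) : ℝ≥0∞ := ⨆ k : ℕ, dimH (torusPackingsWithLinks t n m k)

/-- The Hausdorff measure, in the top dimension, on the space of packings of the torus. -/
def torusHausdorff (t : Set ℂ) (n m : ℕ) : Measure (torusPackings t n m) :=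
  Measure.hausdorffMeasure (topDim t n m).toReal

/-- A packing of the torus, viewed as a periodic packing of the plane. -/
def toPlane (t : Set ℂ) (n m : ℕ) (c : torusPackings t n m) : Packing t :=
  ⟨periodicLift n c.1, c.2.2⟩

/-- The uniform measure on packings of the `n × n` torus by `m` tiles (the Hausdorff measure in the
top dimension, normalized), viewed as a measure on packings of the plane. -/
def uniformMeasure (t : Set ℂ) (n m : ℕ) : Measure (Packing t) :=
  ((torusHausdorff t n m univ)⁻¹ • torusHausdorff t n m).map (toPlane t n m)

/-- `μ` is a limiting measure of density `d`: a weak* limit of uniform probability measures on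
packings of the `n × n` torus by `m` tiles, such that `n → ∞` and `m / n² → d`. -/
def IsLimitMeasure (t : Set ℂ) (d : ℝ) (μ : ProbabilityMeasure (Packing t)) : Prop :=
  ∃ (n m : ℕ → ℕ) (ν : ℕ → ProbabilityMeasure (Packing t)),
    (∀ j, (ν j : Measure (Packing t)) = uniformMeasure t (n j) (m j)) ∧
    Tendsto n atTop atTop ∧
    Tendsto (fun j => (m j : ℝ) / (n j : ℝ) ^ 2) atTop (𝓝 d) ∧
    Tendsto ν atTop (𝓝 μ)

end Packings

end

/-! Let `ρ` bound the radius of the tile. If two centers are more than `2ρ` apart, one tile can be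
translated away to infinity, so linked tiles have centers within `2ρ`. Packings are locally finite,
so an infinite linked component containing the origin yields, for every `k`, a chain of `k` distinct
tiles with steps at most `2ρ` that starts near the origin. It suffices that such a chain has
probability at most `2⁻ᵏ`.

On the torus this is a first-moment estimate for a hard-core gas. Let `Z_m` be the Haar volume of
the compatible `m`-tuples and `γ` a bound for the volume of the positions near a given one.
Splitting off the first tile of the chain costs a factor `(m + 1)γ` and replaces `Z_{m+1}` by `Z_m`.
At low density a compatible `m`-tuple leaves so much free room that `Z_{m+1} ≥ 2Mγ Z_m` for `m ≤ M`,
where `M` is the number of tiles. Each link of the chain therefore gains a factor `1/2`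
(`pi_compatible_chainFrom_le`).

The value of the top dimension is never needed. Passing from ordered to unordered tuples of distinct
points is an `m!`-sheeted local isometry (`hausdorffMeasure_preimage_mk`). The packings contain a
nonempty open set, the tuples with pairwise distant centers, so a translation-invariant Hausdorff
measure that is finite on packings is a multiple of Haar measure
(`exists_hausdorffMeasure_eq_smul`). The bound passes to weak* limits by a portmanteau argument
(`measure_le_of_tendsto`). -/

noncomputable section

namespace Packings

/-! ### Chains in hard-core configurations -/

section HardCore

variable {Z : Type*}

/-- The tuples whose entries are pairwise compatible. -/
def compatible (C : Z → Z → Prop) (m : ℕ) : Set (Fin m → Z) :=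
  {x | Pairwise fun i j => C (x i) (x j)}

/-- The tuple `x` has entries at `k` distinct indices that form a chain for the relation `N`,
the first entry being related to `a`. -/
def ChainFrom (N : Z → Z → Prop) : (k m : ℕ) → Z → (Fin m → Z) → Prop
  | 0, _, _, _ => True
  | _ + 1, 0, _, _ => False
  | k + 1, m + 1, a, x => ∃ i : Fin (m + 1), N a (x i) ∧ ChainFrom N k m (x i) (i.removeNth x)

/-- Delete the index `f 0`; by injectivity the remaining indices avoid it and are renumbered through
`succAbove`. -/
theorem chainFrom_of_injective {N : Z → Z → Prop} {k m : ℕ} {a : Z} {x : Fin m → Z}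
    (f : Fin k → Fin m) (hf : Function.Injective f) (h0 : ∀ i : Fin k, i.1 = 0 → N a (x (f i)))
    (hs : ∀ i j : Fin k, i.1 + 1 = j.1 → N (x (f i)) (x (f j))) : ChainFrom N k m a x := by
  induction k generalizing m a with
  | zero => simp [ChainFrom]
  | succ k ih =>
    cases m with
    | zero => exact (f 0).elim0
    | succ m =>
      have hne : ∀ j : Fin k, ∃ z, (f 0).succAbove z = f j.succ := fun j =>
        Fin.exists_succAbove_eq (hf.ne (Fin.succ_ne_zero j))
      choose g hg using hne
      have hx : ∀ j, (f 0).removeNth x (g j) = x (f j.succ) := fun j => by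
        rw [Fin.removeNth_apply, hg]
      refine ⟨f 0, h0 0 rfl, ih g ?_ ?_ ?_⟩
      · intro i j hij
        have := hg i
        rw [hij, hg j] at this
        exact (Fin.succ_injective _ (hf this)).symm
      · intro i hi
        rw [hx]
        exact hs _ _ (by simp [hi])
      · intro i j hij
        rw [hx, hx]
        exact hs _ _ (by simp [hij])

theorem removeNth_mem_compatible {C : Z → Z → Prop} {m : ℕ} {x : Fin (m + 1) → Z}
    (hx : x ∈ compatible C (m + 1)) (i : Fin (m + 1)) : i.removeNth x ∈ compatible C m :=
  fun _ _ hjl => hx (i.succAbove_right_injective.ne hjl)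

theorem insertNth_zero_mem_compatible {C : Z → Z → Prop} (hC : ∀ a b, C a b → C b a) {m : ℕ} {a : Z}
    {x : Fin m → Z} (hx : x ∈ compatible C m) (ha : ∀ i, C (x i) a) :
    (Fin.insertNth 0 a x : Fin (m + 1) → Z) ∈ compatible C (m + 1) := by
  intro i j hij
  rw [Fin.insertNth_zero]
  induction i using Fin.cases with
  | zero =>
    induction j using Fin.cases with
    | zero => exact absurd rfl hij
    | succ j => simpa using hC _ _ (ha j)
  | succ i =>
    induction j using Fin.cases with
    | zero => simpa using ha i
    | succ j => simpa using hx (fun h => hij (by rw [h]))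

variable [MeasurableSpace Z]

theorem measurableSet_rel {W : Type*} [MeasurableSpace W] {Y : Type*} [MeasurableSpace Y]
    {R : Z → Y → Prop} (hR : MeasurableSet {p : Z × Y | R p.1 p.2}) {f : W → Z} {g : W → Y}
    (hf : Measurable f) (hg : Measurable g) : MeasurableSet {w | R (f w) (g w)} :=
  measurableSet_preimage (t := {p : Z × Y | R p.1 p.2}) (hf.prodMk hg) hR

theorem measurableSet_compatible {C : Z → Z → Prop} (hC : MeasurableSet {p : Z × Z | C p.1 p.2})
    (m : ℕ) : MeasurableSet (compatible C m) := by
  have : compatible C m = ⋂ (i) (j) (_ : i ≠ j), {x | C (x i) (x j)} := by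
    ext x; simp [compatible, Pairwise]
  rw [this]
  refine MeasurableSet.iInter fun i => .iInter fun j => .iInter fun _ => ?_
  exact measurableSet_rel hC (measurable_pi_apply i) (measurable_pi_apply j)

theorem measurable_removeNth {m : ℕ} (i : Fin (m + 1)) :
    Measurable fun x : Fin (m + 1) → Z => i.removeNth x :=
  measurable_pi_lambda _ fun _ => measurable_pi_apply _

theorem measurableSet_chainFrom {N : Z → Z → Prop} (hN : MeasurableSet {p : Z × Z | N p.1 p.2})
    (k m : ℕ) : MeasurableSet {p : Z × (Fin m → Z) | ChainFrom N k m p.1 p.2} := by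
  induction k generalizing m with
  | zero => simp [ChainFrom]
  | succ k ih =>
    cases m with
    | zero => simp [ChainFrom]
    | succ m =>
      simp only [ChainFrom, ofPred_exists]
      refine MeasurableSet.iUnion fun i => MeasurableSet.inter ?_ ?_
      · exact measurableSet_rel hN measurable_fst ((measurable_pi_apply i).comp measurable_snd)
      · exact measurableSet_rel (ih m) ((measurable_pi_apply i).comp measurable_snd)
          ((measurable_removeNth i).comp measurable_snd)

variable (κ : Measure Z)

/-- In low density there is room for one more entry. -/
theorem mul_pi_compatible_le [IsFiniteMeasure κ] {N C : Z → Z → Prop} (hCm : MeasurableSet {p : Z × Z | C p.1 p.2})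
    (hCs : ∀ a b, C a b → C b a) (hNC : ∀ a b, ¬ N a b → C a b) {γ : ℝ≥0∞} (hγ' : γ ≠ ∞)
    (hγ : ∀ a, κ {b | N a b} ≤ γ) {M m : ℕ} (hM : 3 * (M * γ) ≤ κ univ) (hm : m ≤ M) :
    2 * (M * γ) * Measure.pi (fun _ : Fin m => κ) (compatible C m) ≤
      Measure.pi (fun _ : Fin (m + 1) => κ) (compatible C (m + 1)) := by
  have hmp := (measurePreserving_piFinSuccAbove (fun _ : Fin (m + 1) => κ) 0).symm
  have hms := measurableSet_compatible hCm (m + 1)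
  -- Fubini over the entry inserted at index 0: it suffices to bound from below the fibre over each
  -- compatible `x`.
  rw [← hmp.measure_preimage hms.nullMeasurableSet,
    Measure.prod_apply_symm (hmp.measurable hms), ← setLIntegral_const]
  refine (setLIntegral_mono' (measurableSet_compatible hCm m) fun x hx => ?_).trans
    (setLIntegral_le_lintegral _ _)
  have hMγ : M * γ ≠ ∞ := ENNReal.mul_ne_top (by simp) hγ'
  have hbad : κ (⋃ i, {a | N (x i) a}) ≤ M * γ := by
    refine (measure_iUnion_le _).trans ?_
    rw [tsum_fintype]
    refine (Finset.sum_le_sum fun i _ => hγ (x i)).trans ?_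
    simp only [Finset.sum_const, Finset.card_univ, Fintype.card_fin, nsmul_eq_mul]
    gcongr
  have hcov : κ univ ≤ κ ((fun a => (a, x)) ⁻¹'
      ((MeasurableEquiv.piFinSuccAbove (fun _ : Fin (m + 1) => Z) 0).symm ⁻¹'
        compatible C (m + 1))) + M * γ := by
    refine (measure_mono ?_).trans ((measure_union_le _ _).trans (add_le_add_right hbad _))
    intro a _
    by_cases ha : ∃ i, N (x i) a
    · exact Or.inr (mem_iUnion.2 ha)
    · push Not at ha
      exact Or.inl (insertNth_zero_mem_compatible hCs hx fun i => hNC _ _ (ha i))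
  -- The fibre has measure at least `κ univ - Mγ ≥ 3Mγ - Mγ`; the subtraction is avoided by adding
  -- `Mγ` to both sides.
  refine (ENNReal.add_le_add_iff_right hMγ).1 (le_trans ?_ (hM.trans hcov))
  exact le_of_eq (by ring)

/-- Long chains are improbable in low density. -/
theorem pi_compatible_chainFrom_le [IsFiniteMeasure κ] {N C : Z → Z → Prop}
    (hNm : MeasurableSet {p : Z × Z | N p.1 p.2}) (hCm : MeasurableSet {p : Z × Z | C p.1 p.2})
    (hCs : ∀ a b, C a b → C b a) (hNC : ∀ a b, ¬ N a b → C a b) {γ : ℝ≥0∞} (hγ' : γ ≠ ∞)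
    (hγ : ∀ a, κ {b | N a b} ≤ γ) {M : ℕ} (hM : 3 * (M * γ) ≤ κ univ) (k : ℕ) {m : ℕ} (hm : m ≤ M)
    (a : Z) :
    2 ^ k * Measure.pi (fun _ : Fin m => κ) {x ∈ compatible C m | ChainFrom N k m a x} ≤
      Measure.pi (fun _ : Fin m => κ) (compatible C m) := by
  induction k generalizing m a with
  | zero => simp [ChainFrom]
  | succ k ih =>
    cases m with
    | zero => simp [ChainFrom]
    | succ m =>
      set Q : Z → Set (Fin m → Z) := fun b => {x ∈ compatible C m | ChainFrom N k m b x} with hQ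
      have hQm : MeasurableSet {p : Z × (Fin m → Z) | N a p.1 ∧ p.2 ∈ Q p.1} :=
        (measurableSet_rel hNm measurable_const measurable_fst).inter
          ((measurable_snd (measurableSet_compatible hCm m)).inter (measurableSet_chainFrom hNm k m))
      -- With the index `i` of the first chain entry fixed, `x i` ranges over the `N`-neighborhood
      -- of `a`. Its compatibility with the other entries is dropped, and the induction hypothesis
      -- applies to those entries with `x i` as the new starting point.
      have hstep : ∀ i : Fin (m + 1), 2 ^ k * Measure.pi (fun _ : Fin (m + 1) => κ)
          {x | N a (x i) ∧ i.removeNth x ∈ Q (x i)} ≤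
          γ * Measure.pi (fun _ : Fin m => κ) (compatible C m) := by
        intro i
        have hmp := measurePreserving_piFinSuccAbove (fun _ : Fin (m + 1) => κ) i
        have h1 : {x : Fin (m + 1) → Z | N a (x i) ∧ i.removeNth x ∈ Q (x i)} =
            (MeasurableEquiv.piFinSuccAbove (fun _ : Fin (m + 1) => Z) i) ⁻¹'
              {p : Z × (Fin m → Z) | N a p.1 ∧ p.2 ∈ Q p.1} := rfl
        rw [h1, hmp.measure_preimage hQm.nullMeasurableSet, Measure.prod_apply hQm,
          ← lintegral_const_mul' _ _ (by simp)]
        have hNa : MeasurableSet {b | N a b}  :=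
          measurableSet_rel hNm measurable_const measurable_id
        calc _ ≤ ∫⁻ b, {b | N a b}.indicator
                (fun _ => Measure.pi (fun _ : Fin m => κ) (compatible C m)) b ∂κ := by
              refine lintegral_mono fun b => ?_
              by_cases hb : N a b
              · simp only [indicator, mem_ofPred_eq, hb, if_true]
                refine le_trans ?_ (ih (by omega) b)
                gcongr
                exact fun x hx => hx.2
              · simp [hb]
          _ = κ {b | N a b} * Measure.pi (fun _ : Fin m => κ) (compatible C m) := by
              rw [lintegral_indicator_const hNa, mul_comm]
          _ ≤ _ := by gcongr; exact hγ a
      have hsub : {x ∈ compatible C (m + 1) | ChainFrom N (k + 1) (m + 1) a x} ⊆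
          ⋃ i : Fin (m + 1), {x | N a (x i) ∧ i.removeNth x ∈ Q (x i)} := by
        rintro x ⟨hx, i, hi, hc⟩
        exact mem_iUnion.2 ⟨i, hi, removeNth_mem_compatible hx i, hc⟩
      calc _ ≤ 2 ^ (k + 1) * ∑ i : Fin (m + 1), Measure.pi (fun _ : Fin (m + 1) => κ)
            {x | N a (x i) ∧ i.removeNth x ∈ Q (x i)} := by
            gcongr
            refine (measure_mono hsub).trans ((measure_iUnion_le _).trans ?_)
            rw [tsum_fintype]
        _ = 2 * ∑ i : Fin (m + 1), 2 ^ k * Measure.pi (fun _ : Fin (m + 1) => κ)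
            {x | N a (x i) ∧ i.removeNth x ∈ Q (x i)} := by
            rw [← Finset.mul_sum, pow_succ]; ring
        _ ≤ 2 * ∑ i : Fin (m + 1), γ * Measure.pi (fun _ : Fin m => κ) (compatible C m) := by
            exact mul_le_mul_right (Finset.sum_le_sum fun i _ => hstep i) _
        _ ≤ 2 * (M * γ) * Measure.pi (fun _ : Fin m => κ) (compatible C m) := by
            simp only [Finset.sum_const, Finset.card_univ, Fintype.card_fin, nsmul_eq_mul]
            rw [← mul_assoc, ← mul_assoc, ← mul_assoc]
            gcongr
        -- The room for one more entry pays for the `m + 1` choices of `i`, for the neighborhood of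
        -- volume `γ`, and for the new factor 2.
        _ ≤ _ := mul_pi_compatible_le κ hCm hCs hNC hγ' hγ hM (by omega)

/-- In low density there are tuples with pairwise unrelated entries. -/
theorem compatible_not_nonempty {N : Z → Z → Prop} (hNs : ∀ a b, N a b → N b a) {γ : ℝ≥0∞}
    (hγ : ∀ a, κ {b | N a b} ≤ γ) {M m : ℕ} (hM : M * γ < κ univ) (hm : m ≤ M) :
    (compatible (fun a b => ¬ N a b) m).Nonempty := by
  induction m with
  | zero => exact ⟨fun i => i.elim0, fun i => i.elim0⟩
  | succ m ih =>
    obtain ⟨x, hx⟩ := ih (by omega)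
    have hbad : κ (⋃ i, {a | N (x i) a}) < κ univ := by
      refine lt_of_le_of_lt ((measure_iUnion_le _).trans ?_) hM
      rw [tsum_fintype]
      refine (Finset.sum_le_sum fun i _ => hγ (x i)).trans ?_
      simp only [Finset.sum_const, Finset.card_univ, Fintype.card_fin, nsmul_eq_mul]
      gcongr
      omega
    obtain ⟨a, ha⟩ : ∃ a, a ∉ ⋃ i, {a | N (x i) a} := by
      by_contra! h
      exact hbad.ne (by rw [eq_univ_of_forall h])
    exact ⟨_, insertNth_zero_mem_compatible (fun a b h h' => h (hNs _ _ h')) hx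
      fun i h => ha (mem_iUnion.2 ⟨i, h⟩)⟩

end HardCore

/-! ### The Hausdorff measure on unordered tuples -/

/-- Only the pieces `A i` need to be measurable, so the Hausdorff measures of arbitrary sets of
packings can be compared. -/
theorem measure_eq_tsum_inter {X ι : Type*} [MeasurableSpace X] [Countable ι] (μ : Measure X)
    {S : Set X} {A : ι → Set X} (hA : ∀ i, MeasurableSet (A i)) (hd : Pairwise (Function.onFun Disjoint A))
    (hS : S ⊆ ⋃ i, A i) : μ S = ∑' i, μ (S ∩ A i) := by
  have h := measure_iUnion (μ := μ.restrict S) hd hA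
  rw [Measure.restrict_apply (MeasurableSet.iUnion hA), inter_eq_right.2 hS] at h
  rw [h]
  exact tsum_congr fun i => by rw [Measure.restrict_apply (hA i), inter_comm]

namespace UnorderedTuple

variable {Z : Type*} {m : ℕ}

theorem surjective_mk :
    Function.Surjective (mk : PiLp 2 (fun _ : Fin m => Z) → UnorderedTuple Z m) :=
  Quotient.mk_surjective

theorem perm_perm (σ τ : Equiv.Perm (Fin m)) (x : PiLp 2 (fun _ : Fin m => Z)) :
    perm τ (perm σ x) = perm (σ * τ) x := rfl

variable [EMetricSpace Z]

theorem edist_mk_le (x y : PiLp 2 (fun _ : Fin m => Z)) : edist (mk x) (mk y) ≤ edist x y := by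
  rw [edist_mk]
  exact iInf_le_of_le 1 le_rfl

theorem continuous_mk : Continuous (mk : PiLp 2 (fun _ : Fin m => Z) → UnorderedTuple Z m) :=
  LipschitzWith.continuous (K := 1) fun x y => by simpa using edist_mk_le x y

instance [SecondCountableTopology Z] : SecondCountableTopology (UnorderedTuple Z m) := by
  have : TopologicalSpace.SeparableSpace (UnorderedTuple Z m) :=
    surjective_mk.denseRange.separableSpace continuous_mk
  exact UniformSpace.secondCountable_of_separable _

/-- The distinct entries of `x` have distances at least `ε`. -/
def Separated (ε : ℝ≥0∞) (x : PiLp 2 (fun _ : Fin m => Z)) : Prop :=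
  ∀ i j, i ≠ j → ε ≤ edist (x i) (x j)

theorem exists_separated {x : PiLp 2 (fun _ : Fin m => Z)} (hx : (mk x).Distinct) :
    ∃ ε : ℝ≥0∞, 0 < ε ∧ Separated (4 * ε) x := by
  have h : ∀ p : Fin m × Fin m, p.1 ≠ p.2 → 0 < edist (x p.1) (x p.2) := fun p hp =>
    edist_pos.2 fun he => hp (hx x rfl he)
  obtain ⟨ε, hε, h'⟩ : ∃ ε : ℝ≥0∞, 0 < ε ∧ ∀ p : Fin m × Fin m, p.1 ≠ p.2 →
      ε ≤ edist (x p.1) (x p.2) := by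
    -- The value `∞` on the diagonal removes it from the minimum.
    refine ⟨Finset.univ.inf fun p : Fin m × Fin m => if p.1 = p.2 then ∞ else
      edist (x p.1) (x p.2), ?_, fun p hp => ?_⟩
    · rw [Finset.lt_inf_iff (by simp)]
      intro p _
      split_ifs with hp
      · simp
      · exact h p hp
    · refine (Finset.inf_le (Finset.mem_univ p)).trans ?_
      rw [if_neg hp]
  refine ⟨ε / 4, ENNReal.div_pos hε.ne' (by simp), fun i j hij => ?_⟩
  rw [ENNReal.mul_div_cancel (by simp) (by simp)]
  exact h' (i, j) hij

theorem Separated.le_edist_perm {ε : ℝ≥0∞} {x : PiLp 2 (fun _ : Fin m => Z)} (hx : Separated ε x)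
    {σ τ : Equiv.Perm (Fin m)} (h : σ ≠ τ) : ε ≤ edist (perm σ x) (perm τ x) := by
  obtain ⟨i, hi⟩ : ∃ i, σ i ≠ τ i := by
    by_contra! h'
    exact h (Equiv.ext h')
  exact (hx _ _ hi).trans (PiLp.edist_apply_le (perm σ x) (perm τ x) i)

/-- Near a tuple of distinct points, forgetting the order is an isometry. -/
theorem Separated.edist_mk_eq {ε : ℝ≥0∞} {x y z : PiLp 2 (fun _ : Fin m => Z)}
    (hx : Separated (4 * ε) x) (σ : Equiv.Perm (Fin m)) (hy : edist y (perm σ x) < ε)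
    (hz : edist z (perm σ x) < ε) : edist (mk y) (mk z) = edist y z := by
  refine le_antisymm (edist_mk_le y z) ?_
  rw [edist_mk]
  refine le_iInf fun τ => ?_
  by_cases hτ : τ = 1
  · subst hτ
    rfl
  by_contra! hlt
  have hyz : edist y z < ε + ε :=
    (edist_triangle_right y z (perm σ x)).trans_lt (ENNReal.add_lt_add hy hz)
  have h4 : 4 * ε ≤ edist (perm σ x) (perm (σ * τ) x) :=
    hx.le_edist_perm fun h => hτ (by simpa using h.symm)
  have hz' : edist (perm τ z) (perm (σ * τ) x) < ε := by
    rw [← perm_perm, edist_perm]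
    exact hz
  -- If a nontrivial reordering of `z` were closer to `y`, two distinct orderings of `x` would be
  -- within `ε + 2ε + ε`; hence the separation `4 * ε`.
  have : edist (perm σ x) (perm (σ * τ) x) < ε + (ε + ε) + ε := by
    refine (edist_triangle4 _ y (perm τ z) _).trans_lt ?_
    refine ENNReal.add_lt_add (ENNReal.add_lt_add ?_ (hlt.trans hyz)) hz'
    rwa [edist_comm]
  refine absurd this (not_lt.2 (le_trans (le_of_eq ?_) h4))
  ring

theorem preimage_mk_ball (x : PiLp 2 (fun _ : Fin m => Z)) (ε : ℝ≥0∞) :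
    mk ⁻¹' Metric.eball (mk x) ε = ⋃ σ, Metric.eball (perm σ x) ε := by
  ext y
  simp only [mem_preimage, Metric.mem_eball, mem_iUnion]
  constructor
  · intro h
    rw [edist_mk, iInf_lt_iff] at h
    exact h
  · rintro ⟨σ, hσ⟩
    refine lt_of_le_of_lt ?_ hσ
    rw [← mk_perm σ x]
    exact edist_mk_le _ _

theorem Separated.disjoint_ball {ε : ℝ≥0∞} {x : PiLp 2 (fun _ : Fin m => Z)}
    (hx : Separated (4 * ε) x) :
    Pairwise (Function.onFun Disjoint
      fun σ : Equiv.Perm (Fin m) => Metric.eball (perm σ x) ε) := by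
  intro σ τ hστ
  refine Set.disjoint_left.2 fun y hy hy' => ?_
  rw [Metric.mem_eball] at hy hy'
  have h4 := hx.le_edist_perm hστ
  have : edist (perm σ x) (perm τ x) < ε + ε :=
    (edist_triangle_left _ _ y).trans_lt (ENNReal.add_lt_add hy hy')
  refine absurd (h4.trans_lt this) (not_lt.2 ?_)
  calc ε + ε ≤ (ε + ε) + (ε + ε) := le_self_add
    _ = 4 * ε := by ring

variable [MeasurableSpace (PiLp 2 (fun _ : Fin m => Z))] [BorelSpace (PiLp 2 (fun _ : Fin m => Z))]

/-- Forgetting the order is an isometry of the ball about each ordering of `x` onto the ball about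
`mk x`, and isometries preserve Hausdorff measure. -/
theorem Separated.hausdorffMeasure_preimage_inter {s : ℝ} (hs : 0 ≤ s) {ε : ℝ≥0∞}
    {x : PiLp 2 (fun _ : Fin m => Z)} (hx : Separated (4 * ε) x) {A : Set (UnorderedTuple Z m)}
    (hA : A ⊆ Metric.eball (mk x) ε) (σ : Equiv.Perm (Fin m)) :
    Measure.hausdorffMeasure s (mk ⁻¹' A ∩ Metric.eball (perm σ x) ε) =
      Measure.hausdorffMeasure s A := by
  set B := Metric.eball (perm σ x) ε with hB
  have h1 : Isometry ((↑) : B → PiLp 2 (fun _ : Fin m => Z)) := isometry_subtype_coe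
  have h2 : Isometry fun y : B => mk (y : PiLp 2 (fun _ : Fin m => Z)) := fun y z =>
    hx.edist_mk_eq σ y.2 z.2
  have e1 := h1.hausdorffMeasure_image (d := s) (Or.inl hs) ((↑) ⁻¹' (mk ⁻¹' A))
  have e2 := h2.hausdorffMeasure_image (d := s) (Or.inl hs) ((↑) ⁻¹' (mk ⁻¹' A))
  rw [Subtype.image_preimage_coe, inter_comm] at e1
  rw [e1, ← e2]
  congr 1
  ext c
  constructor
  · rintro ⟨y, hy, rfl⟩
    exact hy
  · intro hc
    obtain ⟨y, rfl⟩ := surjective_mk c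
    have hy : y ∈ mk ⁻¹' Metric.eball (mk (perm σ x)) ε := by
      rw [mk_perm]; exact hA hc
    rw [mem_preimage, Metric.mem_eball, edist_comm, edist_mk, iInf_lt_iff] at hy
    obtain ⟨τ, hτ⟩ := hy
    refine ⟨⟨perm τ y, by rw [hB, Metric.mem_eball, edist_comm]; exact hτ⟩, ?_, mk_perm _ _⟩
    simpa [mk_perm] using hc

/-- The preimage of the small ball is the disjoint union of `m!` balls, one for each ordering of
`x`. -/
theorem Separated.hausdorffMeasure_preimage {s : ℝ} (hs : 0 ≤ s) {ε : ℝ≥0∞}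
    {x : PiLp 2 (fun _ : Fin m => Z)} (hx : Separated (4 * ε) x) {A : Set (UnorderedTuple Z m)}
    (hA : A ⊆ Metric.eball (mk x) ε) :
    Measure.hausdorffMeasure s (mk ⁻¹' A) = m.factorial * Measure.hausdorffMeasure s A := by
  rw [measure_eq_tsum_inter _ (fun σ => Metric.isOpen_eball.measurableSet) hx.disjoint_ball
    ((preimage_mono hA).trans (preimage_mk_ball x ε).subset)]
  simp_rw [hx.hausdorffMeasure_preimage_inter hs hA]
  rw [tsum_fintype]
  simp [Fintype.card_perm]

/-- Second countability gives a countable cover of `S` by balls where the local statement holds;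
these are made disjoint and the contributions are summed. -/
theorem hausdorffMeasure_preimage_mk [SecondCountableTopology Z] {s : ℝ} (hs : 0 ≤ s)
    {S : Set (UnorderedTuple Z m)} (hS : ∀ c ∈ S, c.Distinct) :
    Measure.hausdorffMeasure s (mk ⁻¹' S) = m.factorial * Measure.hausdorffMeasure s S := by
  have hloc : ∀ c : UnorderedTuple Z m, ∃ x, ∃ ε : ℝ≥0∞, mk x = c ∧
      (c ∈ S → 0 < ε ∧ Separated (4 * ε) x) := by
    intro c
    obtain ⟨x, rfl⟩ := surjective_mk c
    by_cases hc : mk x ∈ S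
    · obtain ⟨ε, h⟩ := exists_separated (hS _ hc)
      exact ⟨x, ε, rfl, fun _ => h⟩
    · exact ⟨x, 0, rfl, fun h => absurd h hc⟩
  choose x ε hx hε using hloc
  obtain ⟨T, hTS, hTc, hT⟩ := TopologicalSpace.countable_cover_nhdsWithin (s := S)
    (f := fun c => Metric.eball c (ε c))
    fun c hc => mem_nhdsWithin_of_mem_nhds (Metric.eball_mem_nhds c (hε c hc).1)
  rcases T.eq_empty_or_nonempty with rfl | hne
  · have : S = ∅ := by simpa using hT
    simp [this]
  obtain ⟨u, rfl⟩ := hTc.exists_eq_range hne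
  set A : ℕ → Set (UnorderedTuple Z m) := disjointed fun n => Metric.eball (u n) (ε (u n)) with hAdef
  have hAm : ∀ n, MeasurableSet (A n) := fun n =>
    MeasurableSet.disjointed (fun n => Metric.isOpen_eball.measurableSet) n
  have hAd : Pairwise (Function.onFun Disjoint A) := disjoint_disjointed _
  have hAS : S ⊆ ⋃ n, A n := by
    rw [hAdef, iUnion_disjointed]
    simpa using hT
  rw [measure_eq_tsum_inter _ hAm hAd hAS, ← ENNReal.tsum_mul_left,
    measure_eq_tsum_inter _ (A := fun n => mk ⁻¹' A n)
      (fun n => continuous_mk.measurable (hAm n)) (fun i j hij => (hAd hij).preimage _)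
      (by rw [← preimage_iUnion]; exact preimage_mono hAS)]
  refine tsum_congr fun n => ?_
  rw [← preimage_inter]
  refine (hε (u n) (hTS ⟨n, rfl⟩)).2.hausdorffMeasure_preimage hs ?_
  rw [hx]
  exact inter_subset_right.trans (disjointed_subset _ n)

end UnorderedTuple

/-! ### Hausdorff measure on a compact group -/

/-- A Hausdorff measure on a compact group with invariant metric that is finite on some nonempty
open set is a multiple of Haar measure. -/
theorem exists_hausdorffMeasure_eq_smul {E W : Type*} [AddCommGroup E] [EMetricSpace E]
    [IsIsometricVAdd E E] [MeasurableSpace E] [BorelSpace E] [AddCommGroup W] [TopologicalSpace W]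
    [IsTopologicalAddGroup W] [CompactSpace W] [T2Space W] [SecondCountableTopology W]
    [MeasurableSpace W] [BorelSpace W] (ν : Measure W) [ν.IsAddHaarMeasure] (φ : W ≃ₜ E)
    (hφ : ∀ x y, φ (x + y) = φ x + φ y) (s : ℝ) {O : Set E} (hO : IsOpen O) (hne : O.Nonempty)
    (hfin : Measure.hausdorffMeasure s O ≠ ∞) :
    ∃ c : ℝ≥0∞, ∀ S : Set E, Measure.hausdorffMeasure s S = c * ν (φ ⁻¹' S) := by
  set μ : Measure E := Measure.hausdorffMeasure s with hμ
  set e : E ≃ᵐ W := φ.symm.toMeasurableEquiv with he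
  set μ' : Measure W := μ.map e with hμ'
  have hmap : ∀ S : Set W, μ' S = μ (φ '' S) := fun S => by
    rw [hμ', e.map_apply]
    congr 1
    exact (φ.image_eq_preimage_symm S).symm
  have hadd : ∀ (g : E) (S : Set E), μ ((fun y => g + y) '' S) = μ S := fun g S =>
    Isometry.hausdorffMeasure_image (f := fun y => g + y) (isometry_vadd E g)
      (Or.inr (AddGroup.addLeft_bijective g).2) S
  have himg : ∀ (g : W) (S : Set W),
      φ '' ((fun x => g + x) '' S) = (fun y => φ g + y) '' (φ '' S) := by
    intro g S
    rw [image_image, image_image]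
    exact image_congr fun x _ => hφ g x
  have hinv : μ'.IsAddLeftInvariant := by
    refine ⟨fun g => ?_⟩
    ext S hS
    rw [Measure.map_apply (measurable_const_add g) hS, hmap, hmap]
    have := himg g ((fun x => g + x) ⁻¹' S)
    rw [image_preimage_eq _ (AddGroup.addLeft_bijective g).2] at this
    rw [this, hadd]
  have hfc : IsFiniteMeasureOnCompacts μ' := by
    have : IsFiniteMeasure μ' := by
      refine ⟨?_⟩
      -- Finitely many translates of the open set cover the compact group, and each has the same
      -- finite measure.
      obtain ⟨T, hT⟩ := isCompact_univ.elim_finite_subcover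
        (fun g : W => (fun x => g + x) '' (φ ⁻¹' O))
        (fun g => (Homeomorph.addLeft g).isOpenMap _ (hO.preimage φ.continuous))
        (fun x _ => by
          obtain ⟨o, ho⟩ := hne
          refine mem_iUnion.2 ⟨x - φ.symm o, φ.symm o, by simpa using ho, by simp⟩)
      refine (measure_mono hT).trans_lt (measure_biUnion_lt_top T.finite_toSet fun g _ => ?_)
      rw [hmap, himg, hadd, image_preimage_eq _ φ.surjective]
      exact hfin.lt_top
    infer_instance
  -- Uniqueness of Haar measure. The result is an equality of measures, so it applies to sets that
  -- are not measurable as well.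
  have hH := Measure.isAddLeftInvariant_eq_smul μ' ν
  refine ⟨μ'.addHaarScalarFactor ν, fun S => ?_⟩
  have h1 : μ S = μ' (φ ⁻¹' S) := by rw [hmap, image_preimage_eq _ φ.surjective]
  rw [h1]
  conv_lhs => rw [hH]
  rfl

/-! ### Geometry of tiles -/

instance : Fact (0 < Real.pi / 3) := ⟨by positivity⟩

variable {t : Set ℂ}

theorem IsTile.pow_rotation (ht : IsTile t) (k : ℕ) {w : ℂ} (hw : w ∈ t) :
    Complex.exp ((Real.pi / 3 : ℝ) * Complex.I) ^ k * w ∈ t := by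
  induction k with
  | zero => simpa using hw
  | succ k ih =>
    rw [pow_succ', mul_assoc]
    exact ht.rotation _ ih

theorem IsTile.zpow_rotation (ht : IsTile t) (k : ℤ) {w : ℂ} (hw : w ∈ t) :
    Complex.exp ((Real.pi / 3 : ℝ) * Complex.I) ^ k * w ∈ t := by
  have h6 : Complex.exp ((Real.pi / 3 : ℝ) * Complex.I) ^ (6 : ℤ) = 1 := by
    rw [← Complex.exp_int_mul, ← Complex.exp_two_pi_mul_I]
    congr 1
    push_cast
    ring
  have h : Complex.exp ((Real.pi / 3 : ℝ) * Complex.I) ^ k =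
      Complex.exp ((Real.pi / 3 : ℝ) * Complex.I) ^ (k % 6).toNat := by
    conv_lhs => rw [← Int.emod_add_mul_ediv k 6]
    rw [zpow_add₀ (Complex.exp_ne_zero _), zpow_mul, h6, one_zpow, mul_one, ← zpow_natCast,
      Int.toNat_of_nonneg (Int.emod_nonneg _ (by norm_num))]
  rw [h]
  exact ht.pow_rotation _ hw

/-- The rigid motion that moves the tile to the center `c` and rotates it by `θ`. -/
def rigidMotion (c : ℂ) (θ : ℝ) : ℂ ≃ₜ ℂ :=
  (Homeomorph.mulLeft₀ (Complex.exp (θ * Complex.I)) (Complex.exp_ne_zero _)).trans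
    (Homeomorph.addLeft c)

theorem rigidMotion_apply (c : ℂ) (θ : ℝ) (w : ℂ) :
    rigidMotion c θ w = c + Complex.exp (θ * Complex.I) * w := rfl

/-- Two representatives of a direction differ by a multiple of `π / 3`, which the symmetry of the
tile absorbs. -/
theorem IsTile.copy_eq (ht : IsTile t) (c : ℂ) (θ : ℝ) :
    copy t (c, (θ : Direction)) = rigidMotion c θ '' t := by
  ext x
  constructor
  · rintro ⟨θ', hθ, w, hw, rfl⟩
    obtain ⟨k, hk⟩ : ∃ k : ℤ, k • (Real.pi / 3) = θ' - θ :=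
      AddSubgroup.mem_zmultiples_iff.1 (QuotientAddGroup.eq_iff_sub_mem.1 hθ)
    refine ⟨_, ht.zpow_rotation k hw, ?_⟩
    rw [rigidMotion_apply, ← Complex.exp_int_mul, ← mul_assoc, ← Complex.exp_add]
    have : θ' = θ + k * (Real.pi / 3) := by
      rw [zsmul_eq_mul] at hk; linarith
    rw [this]
    congr 4
    push_cast
    ring
  · rintro ⟨w, hw, rfl⟩
    exact ⟨θ, rfl, w, hw, rfl⟩

theorem IsTile.mem_interior_copy (ht : IsTile t) (c : ℂ) (θ : ℝ) (x : ℂ) :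
    x ∈ interior (copy t (c, (θ : Direction))) ↔
      Complex.exp (-(θ * Complex.I)) * (x - c) ∈ interior t := by
  rw [ht.copy_eq, ← Homeomorph.image_interior, Homeomorph.image_eq_preimage_symm, mem_preimage]
  have : (rigidMotion c θ).symm x = Complex.exp (-(θ * Complex.I)) * (x - c) := by
    rw [Homeomorph.symm_apply_eq, rigidMotion_apply, ← mul_assoc, ← Complex.exp_add]
    simp
  rw [this]

theorem IsTile.interior_nonempty (ht : IsTile t) : (interior t).Nonempty := by
  rw [nonempty_iff_ne_empty]
  intro h
  have := ht.closure_interior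
  rw [h, closure_empty] at this
  exact ht.nonempty.ne_empty this.symm

theorem isOpenMap_coe_direction : IsOpenMap fun θ : ℝ => (θ : Direction) :=
  QuotientAddGroup.isOpenMap_coe

/-- The condition is open in the real angle, and the quotient map to directions is open. -/
theorem IsTile.isOpen_mem_interior_copy (ht : IsTile t) (x : ℂ) :
    IsOpen {p : Placement | x ∈ interior (copy t p)} := by
  have hopen : IsOpenMap fun p : ℂ × ℝ => ((p.1, (p.2 : Direction)) : Placement) :=
    IsOpenMap.id.prodMap isOpenMap_coe_direction
  have hU : IsOpen {p : ℂ × ℝ | Complex.exp (-(p.2 * Complex.I)) * (x - p.1) ∈ interior t} :=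
    isOpen_interior.preimage (by fun_prop)
  convert! hopen _ hU
  ext ⟨c, θ⟩
  obtain ⟨θ, rfl⟩ := QuotientAddGroup.mk_surjective θ
  constructor
  · intro h
    exact ⟨(c, θ), (ht.mem_interior_copy c θ x).1 h, rfl⟩
  · rintro ⟨⟨c', θ'⟩, h, he⟩
    rw [← he]
    exact (ht.mem_interior_copy c' θ' x).2 h

theorem NonOverlapping.symm {p q : Placement} (h : NonOverlapping t p q) : NonOverlapping t q p :=
  Disjoint.symm h

theorem not_nonOverlapping_iff {p q : Placement} :
    ¬ NonOverlapping t p q ↔ ∃ x, x ∈ interior (copy t p) ∧ x ∈ interior (copy t q) :=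
  not_disjoint_iff

theorem IsTile.isOpen_overlapping (ht : IsTile t) :
    IsOpen {p : Placement × Placement | ¬ NonOverlapping t p.1 p.2} := by
  have : {p : Placement × Placement | ¬ NonOverlapping t p.1 p.2} =
      ⋃ x, {p : Placement | x ∈ interior (copy t p)} ×ˢ
        {p : Placement | x ∈ interior (copy t p)} := by
    ext p
    simp [not_nonOverlapping_iff]
  rw [this]
  exact isOpen_iUnion fun x => (ht.isOpen_mem_interior_copy x).prod (ht.isOpen_mem_interior_copy x)

theorem IsTile.isClosed_nonOverlapping (ht : IsTile t) :
    IsClosed {p : Placement × Placement | NonOverlapping t p.1 p.2} := by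
  rw [← isOpen_compl_iff]
  exact ht.isOpen_overlapping

theorem IsTile.not_nonOverlapping_self (ht : IsTile t) (p : Placement) :
    ¬ NonOverlapping t p p := by
  obtain ⟨c, θ⟩ := p
  obtain ⟨θ, rfl⟩ := QuotientAddGroup.mk_surjective θ
  obtain ⟨w, hw⟩ := ht.interior_nonempty
  have : c + Complex.exp (θ * Complex.I) * w ∈ interior (copy t (c, (θ : Direction))) := by
    rw [ht.mem_interior_copy, add_sub_cancel_left, ← mul_assoc, ← Complex.exp_add]
    simpa using hw
  exact not_nonOverlapping_iff.2 ⟨_, this, this⟩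

/-- A number that bounds the distance of every point of the tile from its center. -/
def RadiusBound (t : Set ℂ) (ρ : ℝ) : Prop := ∀ w ∈ t, ‖w‖ ≤ ρ

theorem IsTile.exists_radiusBound (ht : IsTile t) : ∃ ρ : ℝ, 0 < ρ ∧ RadiusBound t ρ := by
  obtain ⟨ρ, h0, hρ⟩ := ht.isCompact.isBounded.exists_pos_norm_le
  exact ⟨ρ, h0, hρ⟩

variable {ρ : ℝ}

theorem RadiusBound.norm_sub_le (hρ : RadiusBound t ρ) {p : Placement} {x : ℂ}
    (hx : x ∈ copy t p) : ‖x - p.1‖ ≤ ρ := by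
  obtain ⟨θ, -, w, hw, rfl⟩ := hx
  rw [add_sub_cancel_left, norm_mul, Complex.norm_exp_ofReal_mul_I, one_mul]
  exact hρ w hw

theorem RadiusBound.nonOverlapping (hρ : RadiusBound t ρ) {p q : Placement}
    (h : 2 * ρ < ‖p.1 - q.1‖) : NonOverlapping t p q := by
  by_contra hn
  obtain ⟨x, hp, hq⟩ := not_nonOverlapping_iff.1 hn
  have h1 := hρ.norm_sub_le (interior_subset hp)
  have h2 := hρ.norm_sub_le (interior_subset hq)
  have h3 := norm_sub_le_norm_sub_add_norm_sub p.1 x q.1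
  rw [norm_sub_rev p.1 x] at h3
  linarith

/-- Otherwise the second tile can be translated directly away from the first: the distance of the
centers only grows, so no overlap occurs and the motion is unbounded. -/
theorem RadiusBound.norm_sub_le_of_linked (hρ : RadiusBound t ρ) (h0 : 0 < ρ) {p q : Placement}
    (h : Linked t p q) : ‖p.1 - q.1‖ ≤ 2 * ρ := by
  by_contra! hlt
  set d := q.1 - p.1 with hd
  have hdn : 2 * ρ < ‖d‖ := by rwa [hd, norm_sub_rev]
  have hmem : ∀ s : ℝ, 0 ≤ s → ((q.1 + s • d, q.2) : Placement) ∈ reachable t p q := by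
    intro s hs
    refine JoinedIn.ofLine (f := fun u : ℝ => ((q.1 + (u * s) • d, q.2) : Placement)) ?_ ?_ ?_ ?_
    · fun_prop
    · simp
    · simp
    · rintro _ ⟨u, hu, rfl⟩
      refine hρ.nonOverlapping ?_
      have : p.1 - (q.1 + (u * s) • d) = -((1 + u * s) • d) := by
        rw [hd, add_smul, one_smul]; ring
      rw [this, norm_neg, norm_smul, Real.norm_eq_abs]
      have h1 : 1 ≤ |1 + u * s| := by
        have : 0 ≤ u * s := mul_nonneg hu.1 hs
        rw [abs_of_nonneg (by linarith)]; linarith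
      nlinarith
  obtain ⟨B, hB⟩ := h.2.subset_closedBall q
  -- The factor makes the displacement exactly `|B| + 1`, which exceeds the supposed bound `B`.
  have hBs := hB (hmem ((|B| + 1) / ‖d‖) (by positivity))
  rw [Metric.mem_closedBall] at hBs
  have h1 : dist (q.1 + ((|B| + 1) / ‖d‖) • d) q.1 ≤ B :=
    (le_max_left _ _).trans hBs
  have hd0 : ‖d‖ ≠ 0 := by linarith
  rw [dist_eq_norm, add_sub_cancel_left, norm_smul, Real.norm_eq_abs, abs_of_nonneg (by positivity),
    div_mul_cancel₀ _ hd0] at h1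
  linarith [le_abs_self B]

/-! ### Packings are locally finite -/

/-- Overlapping is an open relation that contains the diagonal, so any two placements close enough
to `x` overlap and a packing has at most one of them. -/
theorem IsTile.exists_nhds_subsingleton (ht : IsTile t) (P : Packing t) (x : Placement) :
    ∃ U ∈ 𝓝 x, (U ∩ P.tiles).Subsingleton := by
  have h : {p : Placement × Placement | ¬ NonOverlapping t p.1 p.2} ∈ 𝓝 (x, x) :=
    ht.isOpen_overlapping.mem_nhds (by exact ht.not_nonOverlapping_self x)
  rw [nhds_prod_eq] at h
  obtain ⟨U, hU, hUU⟩ := mem_prod_same_iff.1 h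
  refine ⟨U, hU, fun p hp q hq => ?_⟩
  by_contra hpq
  exact hUU (mk_mem_prod hp.1 hq.1) (P.2 hp.2 hq.2 hpq)

theorem IsTile.isClosed_tiles (ht : IsTile t) (P : Packing t) : IsClosed P.tiles := by
  rw [← isOpen_compl_iff, isOpen_iff_mem_nhds]
  intro x hx
  obtain ⟨U, hU, hs⟩ := ht.exists_nhds_subsingleton P x
  by_cases hne : (U ∩ P.tiles).Nonempty
  · obtain ⟨y, hy⟩ := hne
    have hxy : x ≠ y := fun h => hx (h ▸ hy.2)
    filter_upwards [hU, isOpen_ne.mem_nhds hxy] with z hz hzy hzP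
    exact hzy (hs ⟨hz, hzP⟩ hy)
  · filter_upwards [hU] with z hz hzP
    exact hne ⟨z, hz, hzP⟩

theorem IsTile.finite_tiles_inter (ht : IsTile t) (P : Packing t) {K : Set Placement}
    (hK : IsCompact K) : (K ∩ P.tiles).Finite := by
  refine hK.induction_on (p := fun S => (S ∩ P.tiles).Finite) (by simp)
    (fun S T hST hT => hT.subset (inter_subset_inter_left _ hST))
    (fun S T hS hT => by rw [union_inter_distrib_right]; exact hS.union hT) fun x _ => ?_
  obtain ⟨U, hU, hs⟩ := ht.exists_nhds_subsingleton P x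
  exact ⟨U, mem_nhdsWithin_of_mem_nhds hU, hs.finite⟩

/-! ### Long chains in infinite components -/

theorem norm_sub_le_length_mul {G : SimpleGraph Placement} {r : ℝ}
    (hG : ∀ a b, G.Adj a b → ‖a.1 - b.1‖ ≤ r) {p q : Placement} (w : G.Walk p q) :
    ‖p.1 - q.1‖ ≤ w.length * r := by
  induction w with
  | nil => simp
  | cons h w ih =>
    refine (norm_sub_le_norm_sub_add_norm_sub _ _ _).trans ((add_le_add (hG _ _ h) ih).trans ?_)
    rw [SimpleGraph.Walk.length_cons]
    push_cast
    linarith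

/-- An infinite component contains arbitrarily long chains of distinct tiles. -/
theorem IsTile.exists_chain_of_infinite (ht : IsTile t) {L : Placement → Placement → Prop} {r : ℝ}
    (hr : 0 ≤ r) (hL : ∀ a b, L a b → ‖a.1 - b.1‖ ≤ r) {P : Packing t} {p : Placement} (hp : p ∈ P.tiles)
    (hinf : (component L P p).Infinite) (k : ℕ) :
    ∃ f : Fin k → Placement, (∀ i, f i ∈ P.tiles) ∧ Function.Injective f ∧
      (∀ i, i.1 = 0 → f i = p) ∧ ∀ i j, i.1 + 1 = j.1 → ‖(f i).1 - (f j).1‖ ≤ r := by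
  set rel : Placement → Placement → Prop := fun a b => a ∈ P.tiles ∧ b ∈ P.tiles ∧ L a b with hrel
  have hcomp : component L P p ⊆ P.tiles := by
    intro q hq
    rcases Relation.ReflTransGen.cases_tail hq with h | ⟨b, -, hb⟩
    · rwa [h]
    · exact hb.2.1
  obtain ⟨q, hq, hfar⟩ : ∃ q ∈ component L P p, k * r < ‖p.1 - q.1‖ := by
    by_contra! h
    refine hinf ((ht.finite_tiles_inter P ((isCompact_closedBall p.1 (k * r)).prod
      (isCompact_univ (X := Direction)))).subset fun q hq => ⟨⟨?_, mem_univ _⟩, hcomp hq⟩)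
    rw [Metric.mem_closedBall, dist_comm, dist_eq_norm]
    exact h q hq
  -- The relation `L` need not be symmetric. Symmetrizing it gives a graph, in which a path supplies
  -- the distinctness of the tiles.
  set G : SimpleGraph Placement := SimpleGraph.fromRel rel with hGdef
  have hG : ∀ a b, G.Adj a b → a ∈ P.tiles ∧ b ∈ P.tiles ∧ ‖a.1 - b.1‖ ≤ r := by
    intro a b hab
    rw [hGdef, SimpleGraph.fromRel_adj] at hab
    rcases hab.2 with h | h
    · exact ⟨h.1, h.2.1, hL _ _ h.2.2⟩
    · exact ⟨h.2.1, h.1, by rw [norm_sub_rev]; exact hL _ _ h.2.2⟩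
  have hreach : G.Reachable p q := by
    have hq' : Relation.ReflTransGen rel p q := hq
    clear hfar hq
    induction hq' with
    | refl => exact SimpleGraph.Reachable.refl _
    | @tail b c _ hbc ih =>
      by_cases hne : b = c
      · exact hne ▸ ih
      · exact ih.trans (SimpleGraph.Adj.reachable
          ((SimpleGraph.fromRel_adj _ _ _).2 ⟨hne, Or.inl hbc⟩))
  obtain ⟨w, hw⟩ := hreach.exists_isPath
  -- Each edge covers at most `r`, so the path to `q` has more than `k` edges. Each of its first `k`
  -- vertices then has a successor, and that edge shows it to be a tile of `P`.
  have hlen : k < w.length := by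
    have h1 := norm_sub_le_length_mul (fun a b h => (hG a b h).2.2) w
    by_contra! hle
    have : (w.length : ℝ) * r ≤ k * r := by gcongr
    linarith
  refine ⟨fun i => w.getVert i, fun i => ?_, fun i j hij => ?_, fun i hi => ?_, fun i j hij => ?_⟩
  · exact (hG _ _ (w.adj_getVert_succ (i.2.trans hlen))).1
  · exact Fin.ext (hw.getVert_injOn (i.2.trans hlen).le (j.2.trans hlen).le hij)
  · simp [hi]
  · have := (hG _ _ (w.adj_getVert_succ (i.2.trans hlen))).2.2
    rwa [hij] at this

/-! ### Continuous functions on the space of packings -/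

variable {k : ℕ}

theorem isOpen_hit {W : Set (Fin k → Placement)} (hW : IsOpen W) :
    IsOpen {P : Packing t | ∃ p ∈ W, ∀ i, p i ∈ P.tiles} := by
  rw [isOpen_iff_forall_mem_open]
  rintro P ⟨p, hpW, hp⟩
  obtain ⟨U, hU, hUW⟩ := isOpen_pi_iff'.1 hW p hpW
  refine ⟨⋂ i, {Q : Packing t | (Q.tiles ∩ U i).Nonempty}, ?_, ?_, ?_⟩
  · intro Q hQ
    choose q hq using mem_iInter.1 hQ
    exact ⟨q, hUW fun i _ => (hq i).2, fun i => (hq i).1⟩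
  · exact isOpen_iInter_of_finite fun i =>
      TopologicalSpace.isOpen_generateFrom_of_mem (Or.inl ⟨U i, (hU i).1, rfl⟩)
  · exact mem_iInter.2 fun i => ⟨p i, hp i, (hU i).2⟩

/-- By compactness this is local in the tuple `p`. Some `p i` lies outside the closed set of tiles,
and it has a compact neighborhood that the packing misses, which is an open event of the Fell
topology. -/
theorem IsTile.isOpen_miss (ht : IsTile t) {K : Set (Fin k → Placement)} (hK : IsCompact K) :
    IsOpen {P : Packing t | ∀ p ∈ K, ∃ i, p i ∉ P.tiles} := by
  rw [isOpen_iff_forall_mem_open]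
  intro P hP
  suffices h : ∃ V : Set (Packing t), IsOpen V ∧ P ∈ V ∧ ∀ Q ∈ V, ∀ p ∈ K, ∃ i, p i ∉ Q.tiles by
    obtain ⟨V, hV, hPV, h⟩ := h
    exact ⟨V, h, hV, hPV⟩
  refine hK.induction_on (p := fun S => ∃ V : Set (Packing t), IsOpen V ∧ P ∈ V ∧
    ∀ Q ∈ V, ∀ p ∈ S, ∃ i, p i ∉ Q.tiles) ⟨univ, isOpen_univ, mem_univ _, by simp⟩ ?_ ?_ ?_
  · rintro S T hST ⟨V, hV, hPV, h⟩
    exact ⟨V, hV, hPV, fun Q hQ p hp => h Q hQ p (hST hp)⟩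
  · rintro S T ⟨V, hV, hPV, h⟩ ⟨V', hV', hPV', h'⟩
    refine ⟨V ∩ V', hV.inter hV', ⟨hPV, hPV'⟩, fun Q hQ p hp => ?_⟩
    exact hp.elim (h Q hQ.1 p) (h' Q hQ.2 p)
  · intro p hp
    obtain ⟨i, hi⟩ := hP p hp
    obtain ⟨N, hN, hpN, hNP⟩ := exists_compact_subset (ht.isClosed_tiles P).isOpen_compl hi
    refine ⟨{q | q i ∈ interior N}, mem_nhdsWithin_of_mem_nhds
      ((isOpen_interior.preimage (continuous_apply i)).mem_nhds hpN),
      {Q | Q.tiles ∩ N = ∅}, TopologicalSpace.isOpen_generateFrom_of_mem (Or.inr ⟨N, hN, rfl⟩),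
      ?_, fun Q hQ q hq => ⟨i, fun hqQ => ?_⟩⟩
    · exact disjoint_iff_inter_eq_empty.1 (disjoint_left.2 fun x hx hxN => hNP hxN hx)
    · exact (hQ ▸ (⟨hqQ, interior_subset hq⟩ : q i ∈ Q.tiles ∩ N) : q i ∈ (∅ : Set Placement))

/-- The supremum of a function over the tuples of tiles of a packing. -/
def supOver (F : (Fin k → Placement) → ℝ) (P : Packing t) : ℝ :=
  ⨆ p : {p : Fin k → Placement // ∀ i, p i ∈ P.tiles}, F p

section supOver

variable {F : (Fin k → Placement) → ℝ} (hF : ∀ p, F p ∈ Icc (0 : ℝ) 1)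

include hF

theorem le_supOver {P : Packing t} {p : Fin k → Placement} (hp : ∀ i, p i ∈ P.tiles) :
    F p ≤ supOver F P :=
  le_ciSup (f := fun p : {p : Fin k → Placement // ∀ i, p i ∈ P.tiles} => F p)
    ⟨1, by rintro _ ⟨q, rfl⟩; exact (hF q).2⟩ ⟨p, hp⟩

theorem supOver_mem_Icc (P : Packing t) : supOver F P ∈ Icc (0 : ℝ) 1 :=
  ⟨Real.iSup_nonneg fun p => (hF p).1, Real.iSup_le (fun p => (hF p).2) zero_le_one⟩

/-- The restriction `0 ≤ c` is needed because the supremum over an empty family of tuples is 0. -/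
theorem lt_supOver_iff {P : Packing t} {c : ℝ} (hc : 0 ≤ c) :
    c < supOver F P ↔ ∃ p, c < F p ∧ ∀ i, p i ∈ P.tiles := by
  constructor
  · intro h
    by_contra! hn
    refine h.not_ge (Real.iSup_le (fun p => ?_) hc)
    by_contra! hlt
    obtain ⟨i, hi⟩ := hn p hlt
    exact hi (p.2 i)
  · rintro ⟨p, h, hp⟩
    exact h.trans_le (le_supOver hF hp)

/-- Lower semicontinuity comes from hitting the open sets `{c < F}`, upper semicontinuity from
missing the sets `{b ≤ F}` with `b > 0`, which are compact because `F` has compact support. -/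
theorem IsTile.continuous_supOver (ht : IsTile t) (hFc : Continuous F) (hFs : HasCompactSupport F) :
    Continuous (supOver F : Packing t → ℝ) := by
  rw [continuous_iff_lower_upperSemicontinuous, lowerSemicontinuous_iff_isOpen_preimage,
    upperSemicontinuous_iff_isOpen_preimage]
  constructor
  · intro c
    rcases lt_or_ge c 0 with hc | hc
    · convert! isOpen_univ
      exact eq_univ_of_forall fun P => hc.trans_le (supOver_mem_Icc hF P).1
    · convert! isOpen_hit (t := t) (hFc.isOpen_preimage _ (isOpen_Ioi (a := c)))
      ext P
      exact lt_supOver_iff hF hc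
  · intro c
    rw [isOpen_iff_forall_mem_open]
    intro P hP
    rw [mem_preimage, mem_Iio] at hP
    obtain ⟨b, hPb, hbc⟩ := exists_between hP
    have hb : 0 < b := (supOver_mem_Icc hF P).1.trans_lt hPb
    have hK : IsCompact {p | b ≤ F p} := by
      refine hFs.isCompact.of_isClosed_subset (isClosed_le continuous_const hFc) fun p hp => ?_
      exact subset_tsupport _ (hb.trans_le hp).ne'
    refine ⟨_, fun Q hQ => ?_, ht.isOpen_miss hK, fun p hp => ?_⟩
    · refine lt_of_le_of_lt (Real.iSup_le (fun p => ?_) hb.le) hbc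
      by_contra! hlt
      obtain ⟨i, hi⟩ := hQ p hlt.le
      exact hi (p.2 i)
    · by_contra! hall
      exact (hPb.trans_le hp).not_ge (le_supOver hF hall)

end supOver

/-- The part of the portmanteau theorem that is needed for limits of measures on packings. -/
theorem IsTile.measure_le_of_tendsto (ht : IsTile t) {K W : Set (Fin k → Placement)}
    (hK : IsCompact K) (hW : IsOpen W) (hKW : K ⊆ W) {ν : ℕ → ProbabilityMeasure (Packing t)}
    {μ : ProbabilityMeasure (Packing t)} (hν : Tendsto ν atTop (𝓝 μ)) {ε : ℝ≥0∞}
    (hε : ∀ᶠ j in atTop, (ν j : Measure (Packing t)) {P | ∃ p ∈ W, ∀ i, p i ∈ P.tiles} ≤ ε) :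
    (μ : Measure (Packing t)) {P | ∃ p ∈ K, ∀ i, p i ∈ P.tiles} ≤ ε := by
  -- For a Urysohn function `F`, the continuous function `supOver F` lies between the indicators of
  -- hitting `K` and of hitting `W`.
  obtain ⟨F, hF1, hF0, hFs, hF⟩ := exists_continuous_one_zero_of_isCompact hK hW.isClosed_compl
    (disjoint_compl_right_iff_subset.2 hKW)
  have hg := ht.continuous_supOver hF F.continuous hFs
  set g : BoundedContinuousFunction (Packing t) NNReal :=
    BoundedContinuousFunction.mkOfBound ⟨fun P => (supOver F P).toNNReal, by fun_prop⟩ 1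
      fun P Q => by
        rw [NNReal.dist_eq]
        have h1 := supOver_mem_Icc hF P
        have h2 := supOver_mem_Icc hF Q
        simp only [ContinuousMap.coe_mk, Real.coe_toNNReal _ h1.1, Real.coe_toNNReal _ h2.1]
        rw [abs_le]
        constructor <;> linarith [h1.1, h1.2, h2.1, h2.2] with hgdef
  have hgP : ∀ P, (g P : ℝ≥0∞) = ENNReal.ofReal (supOver F P) := fun P => rfl
  have hlim := ProbabilityMeasure.tendsto_iff_forall_lintegral_tendsto.1 hν g
  have hle : ∫⁻ P, g P ∂(μ : Measure (Packing t)) ≤ ε := by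
    refine le_of_tendsto hlim (hε.mono fun j hj => le_trans ?_ hj)
    rw [← lintegral_indicator_one (isOpen_hit hW).measurableSet]
    refine lintegral_mono fun P => ?_
    rw [hgP]
    by_cases hP : ∃ p ∈ W, ∀ i, p i ∈ P.tiles
    · rw [indicator_of_mem (by exact hP)]
      simpa using (supOver_mem_Icc hF P).2
    · have : supOver F P ≤ 0 := by
        by_contra! hlt
        obtain ⟨p, h, hp⟩ := (lt_supOver_iff hF le_rfl).1 hlt
        refine h.ne' (hF0 fun hpW => hP ⟨p, hpW, hp⟩)
      rw [ENNReal.ofReal_of_nonpos this]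
      exact zero_le
  refine le_trans ?_ hle
  have hKc : IsClosed {P : Packing t | ∃ p ∈ K, ∀ i, p i ∈ P.tiles} := by
    rw [← isOpen_compl_iff]
    convert! ht.isOpen_miss hK
    ext P
    simp
  rw [← lintegral_indicator_one hKc.measurableSet]
  refine lintegral_mono fun P => ?_
  rw [hgP]
  refine indicator_apply_le' (fun hP => ?_) fun _ => zero_le
  obtain ⟨p, hpK, hp⟩ := hP
  have := le_supOver hF hp
  rw [hF1 hpK] at this
  simpa using this

/-! ### The torus -/

theorem isClosed_rel {X Y : Type*} [TopologicalSpace X] [TopologicalSpace Y] {r : Y → Y → Prop}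
    (hr : IsClosed {p : Y × Y | r p.1 p.2}) {f g : X → Y} (hf : Continuous f)
    (hg : Continuous g) : IsClosed {x | r (f x) (g x)} :=
  IsClosed.preimage (t := {p : Y × Y | r p.1 p.2}) (hf.prodMk hg) hr

/-- The positions on the torus, as a plain product of groups. -/
abbrev TorusPoint (n : ℕ) : Type := AddCircle (n : ℝ) × AddCircle (n : ℝ) × Direction

instance (n : ℕ) : BorelSpace (TorusPoint n) := Prod.borelSpace

instance (n : ℕ) : BorelSpace (TorusPlacement n) := WithLp.borelSpace 2 _ _

instance (n : ℕ) : MeasurableAdd (TorusPoint n) := inferInstance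

instance (n : ℕ) [Fact (0 < (n : ℝ))] : (volume : Measure (TorusPoint n)).IsAddHaarMeasure :=
  Measure.prod.instIsAddHaarMeasure volume
    ((volume : Measure (AddCircle (n : ℝ))).prod (volume : Measure Direction))

variable {n m : ℕ} {R : ℝ}

theorem volume_torusPoint [Fact (0 < (n : ℝ))] : (volume : Measure (TorusPoint n)) univ =
    ENNReal.ofReal n * (ENNReal.ofReal n * ENNReal.ofReal (Real.pi / 3)) := by
  rw [← univ_prod_univ, ← univ_prod_univ, Measure.volume_eq_prod, Measure.prod_prod,
    Measure.volume_eq_prod, Measure.prod_prod]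
  simp only [AddCircle.measure_univ]

/-- The identification of positions on the torus. -/
def torusHomeo (n : ℕ) : TorusPoint n ≃ₜ TorusPlacement n :=
  ((WithLp.homeomorphProd 2 _ _).trans (((WithLp.homeomorphProd 2 _ _).prodCongr
    (Homeomorph.refl Direction)).trans (Homeomorph.prodAssoc _ _ _))).symm

/-- The identification of tuples of positions on the torus. -/
def tupleHomeo (n m : ℕ) : (Fin m → TorusPoint n) ≃ₜ PiLp 2 (fun _ : Fin m => TorusPlacement n) :=
  (Homeomorph.piCongrRight fun _ => torusHomeo n).trans (PiLp.homeomorph 2 _).symm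

theorem tupleHomeo_add (x y : Fin m → TorusPoint n) :
    tupleHomeo n m (x + y) = tupleHomeo n m x + tupleHomeo n m y := rfl

theorem tupleHomeo_apply (x : Fin m → TorusPoint n) (i : Fin m) :
    tupleHomeo n m x i = torusHomeo n (x i) := rfl

/-- The position on the torus of the image of a tile of the plane. -/
def toTorusPoint (n : ℕ) (p : Placement) : TorusPoint n :=
  ((p.1.re : AddCircle (n : ℝ)), (p.1.im : AddCircle (n : ℝ)), p.2)

theorem torusHomeo_toTorusPoint (p : Placement) : torusHomeo n (toTorusPoint n p) = toTorus n p :=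
  rfl

theorem isOpenMap_toTorusPoint : IsOpenMap (toTorusPoint n) := by
  have h1 : IsOpenMap fun x : ℝ => (x : AddCircle (n : ℝ)) := QuotientAddGroup.isOpenMap_coe
  have h2 := (h1.prodMap (h1.prodMap (IsOpenMap.id (X := Direction))))
  exact h2.comp ((Complex.equivRealProdCLM.toHomeomorph.prodCongr
    (Homeomorph.refl Direction)).trans (Homeomorph.prodAssoc _ _ _)).isOpenMap

theorem surjective_toTorusPoint : Function.Surjective (toTorusPoint n) := by
  rintro ⟨a, b, θ⟩
  obtain ⟨a, rfl⟩ := QuotientAddGroup.mk_surjective a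
  obtain ⟨b, rfl⟩ := QuotientAddGroup.mk_surjective b
  exact ⟨(⟨a, b⟩, θ), rfl⟩

theorem abs_ge_of_coe_eq {a b : ℝ} (h : (a : AddCircle (n : ℝ)) = b) (hne : a ≠ b) :
    (n : ℝ) ≤ |a - b| := by
  obtain ⟨z, hz⟩ : ∃ z : ℤ, z • (n : ℝ) = a - b :=
    AddSubgroup.mem_zmultiples_iff.1 (QuotientAddGroup.eq_iff_sub_mem.1 h)
  have hz0 : z ≠ 0 := by
    rintro rfl
    exact hne (by simpa [sub_eq_zero, eq_comm] using hz)
  have h1 : (1 : ℝ) ≤ |(z : ℝ)| := by exact_mod_cast Int.one_le_abs hz0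
  rw [← hz, zsmul_eq_mul, abs_mul, Nat.abs_cast]
  nlinarith [(Nat.cast_nonneg n : (0 : ℝ) ≤ n)]

/-- The directions agree, so some coordinate of the centers differs by a nonzero multiple of `n`. -/
theorem le_norm_sub_of_toTorusPoint_eq {p q : Placement} (h : toTorusPoint n p = toTorusPoint n q)
    (hne : p ≠ q) : (n : ℝ) ≤ ‖p.1 - q.1‖ := by
  obtain ⟨h1, h2⟩ := Prod.ext_iff.1 h
  obtain ⟨h2, h3⟩ := Prod.ext_iff.1 h2
  by_cases hre : p.1.re = q.1.re
  · by_cases him : p.1.im = q.1.im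
    · exact absurd (Prod.ext (Complex.ext hre him) h3) hne
    · exact (abs_ge_of_coe_eq h2 him).trans (Complex.abs_im_le_norm (p.1 - q.1))
  · exact (abs_ge_of_coe_eq h1 hre).trans (Complex.abs_re_le_norm (p.1 - q.1))

/-- The centers are near in both coordinates. -/
def Near (n : ℕ) (R : ℝ) (a b : TorusPoint n) : Prop := ‖a.1 - b.1‖ ≤ R ∧ ‖a.2.1 - b.2.1‖ ≤ R

theorem Near.symm {a b : TorusPoint n} (h : Near n R a b) : Near n R b a := by
  unfold Near
  rwa [norm_sub_rev, norm_sub_rev b.2.1]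

theorem near_toTorusPoint {p q : Placement} (h : ‖p.1 - q.1‖ ≤ R) :
    Near n R (toTorusPoint n p) (toTorusPoint n q) := by
  constructor
  · change ‖((p.1.re - q.1.re : ℝ) : AddCircle (n : ℝ))‖ ≤ R
    exact (QuotientAddGroup.norm_mk_le_norm).trans ((Complex.abs_re_le_norm (p.1 - q.1)).trans h)
  · change ‖((p.1.im - q.1.im : ℝ) : AddCircle (n : ℝ))‖ ≤ R
    exact (QuotientAddGroup.norm_mk_le_norm).trans ((Complex.abs_im_le_norm (p.1 - q.1)).trans h)

theorem isClosed_near : IsClosed {p : TorusPoint n × TorusPoint n | Near n R p.1 p.2} := by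
  simp only [Near, ofPred_and]
  exact (isClosed_le (by fun_prop) continuous_const).inter
    (isClosed_le (by fun_prop) continuous_const)

theorem volume_near_le [Fact (0 < (n : ℝ))] (a : TorusPoint n) :
    (volume : Measure (TorusPoint n)) {b | Near n R a b} ≤
      ENNReal.ofReal (2 * R) * (ENNReal.ofReal (2 * R) * ENNReal.ofReal (Real.pi / 3)) := by
  have hsub : {b | Near n R a b} ⊆
      Metric.closedBall a.1 R ×ˢ (Metric.closedBall a.2.1 R ×ˢ (univ : Set Direction)) := by
    intro b hb
    refine ⟨?_, ?_, mem_univ _⟩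
    · rw [Metric.mem_closedBall, dist_comm, dist_eq_norm]; exact hb.1
    · rw [Metric.mem_closedBall, dist_comm, dist_eq_norm]; exact hb.2
  refine (measure_mono hsub).trans ?_
  rw [Measure.volume_eq_prod, Measure.prod_prod, Measure.volume_eq_prod, Measure.prod_prod,
    AddCircle.volume_closedBall, AddCircle.volume_closedBall, AddCircle.measure_univ]
  gcongr <;> exact min_le_right _ _

/-- No tiles of the plane with the given positions on the torus overlap. -/
def TorusCompatible (t : Set ℂ) (n : ℕ) (a b : TorusPoint n) : Prop :=
  ∀ p q, toTorusPoint n p = a → toTorusPoint n q = b → NonOverlapping t p q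

theorem TorusCompatible.symm {a b : TorusPoint n} (h : TorusCompatible t n a b) :
    TorusCompatible t n b a := fun p q hp hq => (h q p hq hp).symm

/-- The complement is the image of the open set of overlapping pairs under the open projection to
the torus. -/
theorem IsTile.isClosed_torusCompatible (ht : IsTile t) :
    IsClosed {p : TorusPoint n × TorusPoint n | TorusCompatible t n p.1 p.2} := by
  rw [← isOpen_compl_iff]
  convert! (isOpenMap_toTorusPoint (n := n)).prodMap isOpenMap_toTorusPoint _ ht.isOpen_overlapping
  ext ⟨a, b⟩
  simp only [TorusCompatible, mem_compl_iff, mem_ofPred_eq, mem_image, Prod.exists, Prod.map_apply,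
    Prod.mk.injEq]
  push Not
  constructor
  · rintro ⟨p, q, rfl, rfl, h⟩
    exact ⟨p.1, p.2, q.1, q.2, h, rfl, rfl⟩
  · rintro ⟨p, p', q, q', h, h1, h2⟩
    exact ⟨(p, p'), (q, q'), h1, h2, h⟩

theorem IsTile.not_torusCompatible_self (ht : IsTile t) (a : TorusPoint n) :
    ¬ TorusCompatible t n a a := by
  obtain ⟨p, rfl⟩ := surjective_toTorusPoint a
  exact fun h => ht.not_nonOverlapping_self p (h p p rfl rfl)

theorem RadiusBound.torusCompatible_of_not_near (hρ : RadiusBound t ρ) (hR : 2 * ρ ≤ R)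
    (a b : TorusPoint n) (h : ¬ Near n R a b) : TorusCompatible t n a b := by
  rintro p q rfl rfl
  refine hρ.nonOverlapping ?_
  by_contra! hle
  exact h (near_toTorusPoint (hle.trans hR))

theorem mem_periodicLift_mk {x : Fin m → TorusPoint n} {p : Placement} :
    p ∈ periodicLift n (UnorderedTuple.mk (tupleHomeo n m x)) ↔
      ∃ i, x i = toTorusPoint n p := by
  constructor
  · rintro ⟨y, hy, i, hi⟩
    obtain ⟨σ, hσ⟩ := UnorderedTuple.mk_eq_iff.1 hy
    refine ⟨σ.symm i, (torusHomeo n).injective ?_⟩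
    have h1 := hσ (σ.symm i)
    rw [Equiv.apply_symm_apply, tupleHomeo_apply] at h1
    rw [h1, torusHomeo_toTorusPoint]
    exact hi
  · rintro ⟨i, hi⟩
    exact ⟨tupleHomeo n m x, rfl, i, by rw [tupleHomeo_apply, hi]; rfl⟩

theorem distinct_mk_iff {Z : Type*} {x : PiLp 2 (fun _ : Fin m => Z)} :
    (UnorderedTuple.mk x).Distinct ↔ Function.Injective fun i => x i := by
  refine ⟨fun h => h x rfl, fun h y hy => ?_⟩
  obtain ⟨σ, hσ⟩ := UnorderedTuple.mk_eq_iff.1 hy.symm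
  intro i j hij
  simp only [hσ] at hij
  exact σ.injective (h hij)

/-- On a torus wider than `2ρ`, different lifts of one tile never overlap, so only pairs of
different entries matter. Distinctness is automatic, since no position is compatible with itself. -/
theorem IsTile.mk_mem_torusPackings_iff (ht : IsTile t) (hρ : RadiusBound t ρ)
    (hn : 2 * ρ < n) {x : Fin m → TorusPoint n} :
    UnorderedTuple.mk (tupleHomeo n m x) ∈ torusPackings t n m ↔
      x ∈ compatible (TorusCompatible t n) m := by
  have hdist : (UnorderedTuple.mk (tupleHomeo n m x)).Distinct ↔ Function.Injective x := by
    rw [distinct_mk_iff]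
    exact ⟨fun h i j hij => h (congrArg (torusHomeo n) hij),
      fun h i j hij => h ((torusHomeo n).injective hij)⟩
  constructor
  · rintro ⟨hd, hP⟩ i j hij p q hp hq
    refine hP (mem_periodicLift_mk.2 ⟨i, hp.symm⟩) (mem_periodicLift_mk.2 ⟨j, hq.symm⟩) ?_
    rintro rfl
    exact hij (hdist.1 hd (hp.symm.trans hq))
  · intro hx
    refine ⟨hdist.2 fun i j hij => ?_, fun p hp q hq hpq => ?_⟩
    · by_contra hne
      have h : TorusCompatible t n (x i) (x j) := hx hne
      rw [hij] at h
      exact ht.not_torusCompatible_self _ h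
    · obtain ⟨i, hi⟩ := mem_periodicLift_mk.1 hp
      obtain ⟨j, hj⟩ := mem_periodicLift_mk.1 hq
      by_cases hij : i = j
      · subst hij
        exact hρ.nonOverlapping
          (hn.trans_le (le_norm_sub_of_toTorusPoint_eq (hi.symm.trans hj) hpq))
      · exact hx hij p q hi.symm hj.symm

/-! ### Chains of tiles -/

theorem norm_le_of_chain {f : Fin k → Placement} (hR : 0 ≤ R)
    (h0 : ∀ i : Fin k, i.1 = 0 → ‖(f i).1‖ ≤ R)
    (hs : ∀ i j : Fin k, i.1 + 1 = j.1 → ‖(f i).1 - (f j).1‖ ≤ R) (i : Fin k) :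
    ‖(f i).1‖ ≤ k * R := by
  have h : ∀ (l : ℕ) (hl : l < k), ‖(f ⟨l, hl⟩).1‖ ≤ (l + 1 : ℕ) * R := by
    intro l
    induction l with
    | zero => intro hl; simpa using h0 ⟨0, hl⟩ rfl
    | succ l ih =>
      intro hl
      have h1 := ih (by omega)
      have h2 := hs ⟨l, by omega⟩ ⟨l + 1, hl⟩ rfl
      have h3 := norm_sub_norm_le (f ⟨l + 1, hl⟩).1 (f ⟨l, by omega⟩).1
      rw [norm_sub_rev] at h3
      push_cast at h1 ⊢
      linarith
  refine (h i.1 i.2).trans ?_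
  have : i.1 + 1 ≤ k := i.2
  gcongr

/-- The tuples of distinct placements that form a chain starting near the origin. -/
def chains (k : ℕ) (R : ℝ) : Set (Fin k → Placement) :=
  {f | (∀ i : Fin k, i.1 = 0 → ‖(f i).1‖ < R) ∧
    (∀ i j : Fin k, i.1 + 1 = j.1 → ‖(f i).1 - (f j).1‖ < R) ∧ ∀ i j, i ≠ j → f i ≠ f j}

/-- The tuples of pairwise nonoverlapping placements that form a chain starting near the origin. -/
def packedChains (t : Set ℂ) (k : ℕ) (R : ℝ) : Set (Fin k → Placement) :=
  {f | (∀ i : Fin k, i.1 = 0 → ‖(f i).1‖ ≤ R) ∧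
    (∀ i j : Fin k, i.1 + 1 = j.1 → ‖(f i).1 - (f j).1‖ ≤ R) ∧
      ∀ i j, i ≠ j → NonOverlapping t (f i) (f j)}

theorem isOpen_chains : IsOpen (chains k R) := by
  simp only [chains, ofPred_and, ofPred_forall]
  refine IsOpen.inter ?_ (IsOpen.inter ?_ ?_)
  · exact isOpen_iInter_of_finite fun i => isOpen_iInter_of_finite fun _ =>
      isOpen_lt (by fun_prop) continuous_const
  · exact isOpen_iInter_of_finite fun i => isOpen_iInter_of_finite fun j =>
      isOpen_iInter_of_finite fun _ => isOpen_lt (by fun_prop) continuous_const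
  · exact isOpen_iInter_of_finite fun i => isOpen_iInter_of_finite fun j =>
      isOpen_iInter_of_finite fun _ => isOpen_ne_fun (by fun_prop) (by fun_prop)

theorem IsTile.isCompact_packedChains (ht : IsTile t) (hR : 0 ≤ R) :
    IsCompact (packedChains t k R) := by
  have hc : IsClosed (packedChains t k R) := by
    simp only [packedChains, ofPred_and, ofPred_forall]
    refine IsClosed.inter ?_ (IsClosed.inter ?_ ?_)
    · exact isClosed_iInter fun i => isClosed_iInter fun _ =>
        isClosed_le (by fun_prop) continuous_const
    · exact isClosed_iInter fun i => isClosed_iInter fun j => isClosed_iInter fun _ =>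
        isClosed_le (by fun_prop) continuous_const
    · exact isClosed_iInter fun i => isClosed_iInter fun j => isClosed_iInter fun _ =>
        isClosed_rel ht.isClosed_nonOverlapping (continuous_apply i) (continuous_apply j)
  refine (isCompact_univ_pi fun _ : Fin k => (isCompact_closedBall (0 : ℂ) (k * R)).prod
    (isCompact_univ (X := Direction))).of_isClosed_subset hc fun f hf i _ => ⟨?_, mem_univ _⟩
  rw [mem_closedBall_zero_iff]
  exact norm_le_of_chain hR hf.1 hf.2.1 i

/-- This is the compact-in-open pair for the passage to the limit. Nonoverlapping is a closed
condition; in the open set it is relaxed to distinctness, which still suffices for counting. -/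
theorem IsTile.packedChains_subset (ht : IsTile t) {R' : ℝ} (hR : R < R') :
    packedChains t k R ⊆ chains k R' := fun f hf =>
  ⟨fun i hi => (hf.1 i hi).trans_lt hR, fun i j hij => (hf.2.1 i j hij).trans_lt hR,
    fun i j hij h => ht.not_nonOverlapping_self (f j) (by simpa [h] using hf.2.2 i j hij)⟩

/-- The chain stays within `k * R` of the origin. As `2 * (k * R) < n`, it does not wrap around the
torus, so its distinct tiles correspond to distinct indices of `x`. -/
theorem chainFrom_of_mem_chains (hR : 0 < R) (hn : 2 * (k * R) < n) {f : Fin k → Placement}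
    (hf : f ∈ chains k R) {x : Fin m → TorusPoint n}
    (hfx : ∀ i, f i ∈ periodicLift n (UnorderedTuple.mk (tupleHomeo n m x))) :
    ChainFrom (Near n R) k m 0 x := by
  choose g hg using fun i => mem_periodicLift_mk.1 (hfx i)
  have hnorm := norm_le_of_chain hR.le (fun i hi => (hf.1 i hi).le)
    fun i j hij => (hf.2.1 i j hij).le
  refine chainFrom_of_injective g (fun i j hij => ?_) (fun i hi => ?_) fun i j hij => ?_
  · by_contra hne
    have h := hg i
    rw [hij, hg j] at h
    have h1 := le_norm_sub_of_toTorusPoint_eq h.symm (hf.2.2 i j hne)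
    have h2 := norm_sub_le (f i).1 (f j).1
    linarith [hnorm i, hnorm j]
  · rw [hg]
    have := near_toTorusPoint (n := n) (p := 0) (q := f i) (R := R)
      (by simpa using (hf.1 i hi).le)
    have h00 : toTorusPoint n 0 = 0 := by simp [toTorusPoint]
    rwa [h00] at this
  · rw [hg, hg]
    exact near_toTorusPoint (hf.2.1 i j hij).le

/-! ### The uniform measures -/

/-- In low density, chains have small Hausdorff measure in the space of packings of the torus. -/
theorem IsTile.hausdorffMeasure_le (ht : IsTile t) (hρ : RadiusBound t ρ) (h0 : 0 < ρ)
    (hR : 2 * ρ ≤ R) (hnR : 2 * ρ < n) (hnk : 2 * (k * R) < n)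
    (hd : 3 * (m * (2 * R) ^ 2) ≤ (n : ℝ) ^ 2) {s : ℝ} (hs : 0 ≤ s)
    (hfin : Measure.hausdorffMeasure s (torusPackings t n m) ≠ ∞)
    {A : Set (UnorderedTuple (TorusPlacement n) m)} (hA : A ⊆ torusPackings t n m)
    (hAc : ∀ c ∈ A, ∃ f ∈ chains k R, ∀ i, f i ∈ periodicLift n c) :
    2 ^ k * Measure.hausdorffMeasure s A ≤ Measure.hausdorffMeasure s (torusPackings t n m) := by
  have hn : Fact (0 < (n : ℝ)) := ⟨by linarith⟩
  set γ : ℝ≥0∞ := ENNReal.ofReal (2 * R) * (ENNReal.ofReal (2 * R) * ENNReal.ofReal (Real.pi / 3))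
    with hγdef
  have hγ' : γ ≠ ∞ := by simp [hγdef, ENNReal.mul_eq_top]
  have hγ : ∀ a, (volume : Measure (TorusPoint n)) {b | Near n R a b} ≤ γ := volume_near_le
  -- Both sides contain the factor `π / 3` of the directions; without it this is `hd`.
  have hV : 3 * (m * γ) ≤ (volume : Measure (TorusPoint n)) univ := by
    rw [volume_torusPoint, hγdef]
    have h2R : 0 ≤ 2 * R := by linarith
    have h3 : (3 : ℝ≥0∞) = ENNReal.ofReal 3 := by simp
    have hm : (m : ℝ≥0∞) = ENNReal.ofReal m := by simp
    rw [h3, hm, ← ENNReal.ofReal_mul h2R, ← ENNReal.ofReal_mul h2R,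
      ← ENNReal.ofReal_mul (by positivity), ← ENNReal.ofReal_mul (by positivity),
      ← ENNReal.ofReal_mul (by positivity), ← ENNReal.ofReal_mul (by positivity)]
    refine ENNReal.ofReal_le_ofReal ?_
    have := mul_le_mul_of_nonneg_right hd (by positivity : 0 ≤ Real.pi / 3)
    linarith
  have hVpos : 0 < (volume : Measure (TorusPoint n)) univ := by
    rw [volume_torusPoint]
    have := hn.out
    have : 0 < Real.pi / 3 := by positivity
    simp only [pos_iff_ne_zero, ne_eq, mul_eq_zero, ENNReal.ofReal_eq_zero, not_or, not_le]
    exact ⟨hn.out, hn.out, this⟩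
  have hV' : m * γ < (volume : Measure (TorusPoint n)) univ := by
    rcases eq_or_ne (m * γ) 0 with h | h
    · rwa [h]
    · refine lt_of_lt_of_le ?_ hV
      have hfin : (m : ℝ≥0∞) * γ ≠ ∞ := ENNReal.mul_ne_top (by simp) hγ'
      calc (m : ℝ≥0∞) * γ = 1 * (m * γ) := (one_mul _).symm
        _ < 3 * (m * γ) := (ENNReal.mul_lt_mul_iff_left h hfin).2 (by norm_num)
  have hdist : ∀ c ∈ torusPackings t n m, c.Distinct := fun c hc => hc.1
  have hcomp : tupleHomeo n m ⁻¹' (UnorderedTuple.mk ⁻¹' torusPackings t n m) =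
      compatible (TorusCompatible t n) m := by
    ext x
    exact ht.mk_mem_torusPackings_iff hρ hnR
  have hX := UnorderedTuple.hausdorffMeasure_preimage_mk hs hdist
  have hAm := UnorderedTuple.hausdorffMeasure_preimage_mk hs fun c hc => hdist c (hA hc)
  -- Tuples with no two positions near each other form a nonempty open set of packings. Finiteness
  -- of the Hausdorff measure there makes it a multiple of Haar measure.
  have hOo : IsOpen (compatible (fun a b => ¬ Near n R a b) m) := by
    simp only [compatible, Pairwise, ofPred_forall]
    exact isOpen_iInter_of_finite fun i => isOpen_iInter_of_finite fun j =>
      isOpen_iInter_of_finite fun _ =>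
        (isClosed_rel isClosed_near (continuous_apply i) (continuous_apply j)).isOpen_compl
  obtain ⟨c, hc⟩ := exists_hausdorffMeasure_eq_smul
    (Measure.pi fun _ : Fin m => (volume : Measure (TorusPoint n))) (tupleHomeo n m)
    tupleHomeo_add s ((tupleHomeo n m).isOpenMap _ hOo)
    ((compatible_not_nonempty volume (fun a b => Near.symm) hγ hV' le_rfl).image _) (by
      refine ne_top_of_le_ne_top ?_ (measure_mono (t := UnorderedTuple.mk ⁻¹' torusPackings t n m) ?_)
      · rw [hX]
        exact ENNReal.mul_ne_top (by simp) hfin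
      · rw [image_subset_iff, hcomp]
        exact fun x hx i j hij => hρ.torusCompatible_of_not_near hR _ _ (hx hij))
  rw [hc, hcomp] at hX
  rw [hc] at hAm
  have hsub : tupleHomeo n m ⁻¹' (UnorderedTuple.mk ⁻¹' A) ⊆
      {x ∈ compatible (TorusCompatible t n) m | ChainFrom (Near n R) k m 0 x} := by
    intro x hx
    obtain ⟨f, hf, hfx⟩ := hAc _ hx
    exact ⟨(ht.mk_mem_torusPackings_iff hρ hnR).1 (hA hx),
      chainFrom_of_mem_chains (by linarith) hnk hf hfx⟩
  have hmain := pi_compatible_chainFrom_le (volume : Measure (TorusPoint n))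
    isClosed_near.measurableSet ht.isClosed_torusCompatible.measurableSet
    (fun a b => TorusCompatible.symm) (hρ.torusCompatible_of_not_near hR) hγ' hγ hV k le_rfl 0
  -- The factor `m!` and the Haar constant are common to both sides. The Haar constant may be 0, so
  -- only `m!` is cancelled.
  have hm0 : (m.factorial : ℝ≥0∞) ≠ 0 := by exact_mod_cast m.factorial_ne_zero
  refine (ENNReal.mul_le_mul_iff_right hm0 (by simp)).1 ?_
  rw [← hX, mul_left_comm, ← hAm, mul_left_comm]
  refine mul_le_mul_right (le_trans ?_ hmain) _
  exact mul_le_mul_right (measure_mono hsub) _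

theorem IsTile.uniformMeasure_le (ht : IsTile t) (hρ : RadiusBound t ρ) (h0 : 0 < ρ)
    (hR : 2 * ρ ≤ R) (hnR : 2 * ρ < n) (hnk : 2 * (k * R) < n)
    (hd : 3 * (m * (2 * R) ^ 2) ≤ (n : ℝ) ^ 2) (hprob : uniformMeasure t n m univ = 1) :
    uniformMeasure t n m {P | ∃ f ∈ chains k R, ∀ i, f i ∈ P.tiles} ≤ (2⁻¹) ^ k := by
  have hs : 0 ≤ (topDim t n m).toReal := ENNReal.toReal_nonneg
  -- Otherwise the pushforward would be 0 by convention, contrary to total mass 1.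
  have hae : AEMeasurable (toPlane t n m)
      ((torusHausdorff t n m univ)⁻¹ • torusHausdorff t n m) := by
    by_contra h
    rw [uniformMeasure, Measure.map_of_not_aemeasurable h] at hprob
    simp at hprob
  have hcoe : ∀ S, torusHausdorff t n m S =
      Measure.hausdorffMeasure (topDim t n m).toReal (Subtype.val '' S) := fun S =>
    ((isometry_subtype_coe (s := torusPackings t n m)).hausdorffMeasure_image (Or.inl hs) S).symm
  -- An infinite total mass has inverse 0, which would make the normalized measure vanish.
  have hne : torusHausdorff t n m univ ≠ ∞ := by
    intro h
    rw [uniformMeasure, Measure.map_apply_of_aemeasurable hae MeasurableSet.univ] at hprob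
    simp [h] at hprob
  have huniv := hcoe univ
  rw [image_univ, Subtype.range_coe] at huniv
  rw [uniformMeasure, Measure.map_apply_of_aemeasurable hae (isOpen_hit isOpen_chains).measurableSet,
    Measure.smul_apply, smul_eq_mul,
    hcoe (toPlane t n m ⁻¹' _)]
  have hmain := ht.hausdorffMeasure_le hρ h0 hR hnR hnk hd hs (huniv ▸ hne)
    (A := Subtype.val '' (toPlane t n m ⁻¹' {P | ∃ f ∈ chains k R, ∀ i, f i ∈ P.tiles}))
    (Subtype.coe_image_subset _ _) (by rintro _ ⟨c, hc, rfl⟩; exact hc)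
  rw [← huniv] at hmain
  rw [← ENNReal.inv_pow, ENNReal.le_inv_iff_mul_le, mul_assoc, mul_comm _ (2 ^ k)]
  exact (mul_le_mul_right hmain _).trans (ENNReal.inv_mul_le_one _)

theorem IsTile.limitMeasure_originInInfinite (ht : IsTile t) (hρ : RadiusBound t ρ) (h0 : 0 < ρ)
    {d : ℝ} (hd : d < 1 / (12 * (2 * ρ + 1) ^ 2)) {μ : ProbabilityMeasure (Packing t)}
    (hμ : IsLimitMeasure t d μ) {L : Placement → Placement → Prop}
    (hL : ∀ a b, L a b → Linked t a b) :
    (μ : Measure (Packing t)) (originInInfinite L) = 0 := by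
  obtain ⟨n, m, ν, hν, hn, hmn, hlim⟩ := hμ
  have hn' : Tendsto (fun j => (n j : ℝ)) atTop atTop := tendsto_natCast_atTop_atTop.comp hn
  have hk : ∀ k : ℕ, (μ : Measure (Packing t)) (originInInfinite L) ≤ (2⁻¹) ^ k := by
    intro k
    refine (measure_mono ?_).trans (ht.measure_le_of_tendsto
      (ht.isCompact_packedChains (k := k) (R := 2 * ρ) (by positivity)) isOpen_chains
      (ht.packedChains_subset (lt_add_one _)) hlim ?_)
    · rintro P ⟨p, hp, hp0, hinf⟩
      obtain ⟨f, hf, hinj, hf0, hstep⟩ := ht.exists_chain_of_infinite (by positivity)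
        (fun a b h => hρ.norm_sub_le_of_linked h0 (hL a b h)) hp hinf k
      refine ⟨f, ⟨fun i hi => ?_, hstep, fun i j hij => P.2 (hf i) (hf j) (hinj.ne hij)⟩, hf⟩
      rw [hf0 i hi]
      have := hρ.norm_sub_le hp0
      rw [zero_sub, norm_neg] at this
      linarith
    · filter_upwards [hn'.eventually_gt_atTop (2 * ρ),
        hn'.eventually_gt_atTop (2 * (k * (2 * ρ + 1))),
        hmn.eventually_lt_const hd] with j h1 h2 h3
      rw [hν j]
      have hnpos : 0 < (n j : ℝ) := by linarith
      refine ht.uniformMeasure_le hρ h0 (by linarith) h1 h2 ?_ ?_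
      · rw [div_lt_div_iff₀ (by positivity) (by positivity)] at h3
        linarith
      · rw [← hν j]
        exact measure_univ
  refine le_antisymm ?_ zero_le
  exact ge_of_tendsto' (ENNReal.tendsto_pow_atTop_nhds_zero_of_lt_one
    (by simp : (2⁻¹ : ℝ≥0∞) < 1)) hk

end Packings

end

theorem mainTheorem3 (t : Set ℂ) (ht : Packings.IsTile t) :
    ∃ d₂ : ℝ, 0 < d₂ ∧ ∀ d : ℝ, d < d₂ →
      ∀ μ : MeasureTheory.ProbabilityMeasure (Packings.Packing t),
        Packings.IsLimitMeasure t d μ →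
          (μ : MeasureTheory.Measure (Packings.Packing t))
              (Packings.originInInfinite (Packings.Linked t)) = 0 ∧
          (μ : MeasureTheory.Measure (Packings.Packing t))
              (Packings.originInInfinite (Packings.LooseLinked t)) = 0 := by
  obtain ⟨ρ, h0, hρ⟩ := ht.exists_radiusBound
  -- The torus estimate needs `3 * m * (2 * R) ^ 2 ≤ n ^ 2`. It is used with `R = 2ρ + 1`, slightly
  -- more than the length `2ρ` of a link, to make room for the open set of chains.
  refine ⟨1 / (12 * (2 * ρ + 1) ^ 2), by positivity, fun d hd μ hμ => ⟨?_, ?_⟩⟩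
  · exact ht.limitMeasure_originInInfinite hρ h0 hd hμ fun _ _ h => h
  · exact ht.limitMeasure_originInInfinite hρ h0 hd hμ fun _ _ h => h.1
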